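/- Let $L \subset \mathbb{R}^2$ be a 2-dimensional lattice (a discrete, co-compact subgroup of $\mathbb{R}^2$). A basis $(v_1, v_2)$ of $L$ is called a Minkowski basis if $|v_1| \le |v_2|$ and $2\,|\langle v_1, v_2\rangle| \le |v_1|^2$; every such lattice has a Minkowski basis. For $\alpha > 0$ the centered and the alternating theta function of $L$ are $$\theta^c_L(\alpha) = \sum_{k,l\in\mathbb{Z}} e^{-\pi\alpha\,\left|(k+\frac12)v_1 + (l+\frac12)v_2\right|^2}, \qquad \theta^{\pm}_L(\alpha) = \sum_{k,l\in\mathbb{Z}} (-1)^{k+l}\, e^{-\pi\alpha\,\left|k v_1 + l v_2\right|^2},$$ where $(v_1,v_2)$ is a Minkowski basis of $L$; the values do not depend on which one is chosen. Let $$\mathsf{A}_2 = \sqrt{\tfrac{2}{\sqrt3}} \begin{pmatrix} 1 & \tfrac12 \\ 0 & \tfrac{\sqrt3}{2} \end{pmatrix} \mathbb{Z}^2$$ be the hexagonal lattice of volume 1. Theorem. For every $\alpha > 0$ and every 2-dimensional lattice $L$ of volume 1, $$\theta^c_{\mathsf{A}_2}(\alpha) \ge \theta^c_L(\alpha) \qquad\text{and}\qquad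 \theta^{\pm}_{\mathsf{A}_2}(\alpha) \ge \theta^{\pm}_L(\alpha).$$ In each of the two inequalities equality holds if and only if $L$ is a rotated version of $\mathsf{A}_2$, i.e. $L = Q\,\mathsf{A}_2$ for some $Q \in SO(2,\mathbb{R})$. -/

import Mathlib

open MeasureTheory

/-- A basis `(v₁, v₂)` of a lattice in the Euclidean plane is a Minkowski (reduced) basis:
`|v₁| ≤ |v₂|` and `2 |⟨v₁, v₂⟩| ≤ |v₁|²`. If, after a rotation and a rescaling,
`v₁ = (1, 0)` and `v₂ = (x, y)`, these say `x² + y² ≥ 1` and `|x| ≤ 1/2`. -/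
structure IsMinkowskiBasis {L : Submodule ℤ (EuclideanSpace ℝ (Fin 2))}
    (b : Module.Basis (Fin 2) ℤ L) : Prop where
  norm_le : ‖b 0‖ ≤ ‖b 1‖
  inner_le : 2 * |inner ℝ (b 0 : EuclideanSpace ℝ (Fin 2)) (b 1)| ≤ ‖b 0‖ ^ 2

/-- Replacing the second vector of a lattice basis by its sum with `m` times the first one. -/
theorem exists_shear {L : Submodule ℤ (EuclideanSpace ℝ (Fin 2))}
    (b : Module.Basis (Fin 2) ℤ L) (m : ℤ) :
    ∃ b' : Module.Basis (Fin 2) ℤ L, b' 0 = b 0 ∧ b' 1 = b 1 + m • b 0 := by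
  have hli : LinearIndependent ℤ ![b 0, b 1 + m • b 0] := by
    rw [LinearIndependent.pair_iff]
    intro s t h
    have hb : LinearIndependent ℤ ![b 0, b 1] := by
      convert b.linearIndependent using 1
      ext i
      fin_cases i <;> rfl
    rw [LinearIndependent.pair_iff] at hb
    have h2 : (s + t * m) • b 0 + t • b 1 = 0 := by
      rw [← h]
      module
    obtain ⟨h3, h4⟩ := hb _ _ h2
    subst h4
    simpa using h3
  have hsp : ⊤ ≤ Submodule.span ℤ (Set.range ![b 0, b 1 + m • b 0]) := by
    rw [← b.span_eq, Submodule.span_le]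
    have h0 : b 0 ∈ Submodule.span ℤ (Set.range ![b 0, b 1 + m • b 0]) :=
      Submodule.subset_span ⟨0, rfl⟩
    have h1 : b 1 + m • b 0 ∈ Submodule.span ℤ (Set.range ![b 0, b 1 + m • b 0]) :=
      Submodule.subset_span ⟨1, rfl⟩
    rintro _ ⟨i, rfl⟩
    fin_cases i
    · exact h0
    · have := Submodule.sub_mem _ h1 (Submodule.smul_mem _ m h0)
      simpa using this
  exact ⟨Module.Basis.mk hli hsp, by simp, by simp⟩

/-- Every lattice in the plane has a Minkowski basis. -/
theorem exists_isMinkowskiBasis (L : Submodule ℤ (EuclideanSpace ℝ (Fin 2)))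
    [DiscreteTopology L] [IsZLattice ℝ L] :
    ∃ b : Module.Basis (Fin 2) ℤ L, IsMinkowskiBasis b := by
  have : Module.Finite ℤ L := ZLattice.module_finite ℝ L
  have : Module.Free ℤ L := ZLattice.module_free ℝ L
  have hr : Module.finrank ℤ L = 2 := by
    rw [ZLattice.rank ℝ L]
    simp
  let b₀ : Module.Basis (Fin 2) ℤ L := Module.finBasisOfFinrankEq ℤ L hr
  let f : Module.Basis (Fin 2) ℤ L → ℝ := fun b => ‖b 0‖ ^ 2 + ‖b 1‖ ^ 2
  let R : ℝ := Real.sqrt (f b₀)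
  have hfin : Set.Finite {v : L | ‖v‖ ≤ R} := by
    have h1 : Set.Finite (Metric.closedBall (0 : EuclideanSpace ℝ (Fin 2)) R ∩
        (L : Set (EuclideanSpace ℝ (Fin 2)))) := by
      have : DiscreteTopology L.toAddSubgroup := inferInstanceAs (DiscreteTopology L)
      apply Metric.finite_isBounded_inter_isClosed
      · exact (inferInstance : DiscreteTopology L).isDiscrete
      · exact Metric.isBounded_closedBall
      · exact AddSubgroup.isClosed_of_discrete (H := L.toAddSubgroup)
    apply Set.Finite.of_finite_image (f := Subtype.val) _ Subtype.val_injective.injOn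
    refine h1.subset ?_
    rintro _ ⟨v, hv, rfl⟩
    exact ⟨by simpa using hv, v.2⟩
  have hfinB : Set.Finite {b : Module.Basis (Fin 2) ℤ L | f b ≤ f b₀} := by
    apply Set.Finite.of_finite_image (f := fun b => (b 0, b 1))
    · refine (hfin.prod hfin).subset ?_
      rintro _ ⟨b, hb, rfl⟩
      simp only [Set.mem_ofPred_eq] at hb
      constructor
      · exact Real.le_sqrt_of_sq_le (by simp only [f] at hb ⊢; nlinarith [sq_nonneg ‖b 1‖])
      · exact Real.le_sqrt_of_sq_le (by simp only [f] at hb ⊢; nlinarith [sq_nonneg ‖b 0‖])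
    · intro b _ b' _ h
      simp only [Prod.mk.injEq] at h
      apply Module.Basis.eq_of_apply_eq
      intro i
      fin_cases i
      · exact h.1
      · exact h.2
  obtain ⟨b₁, hb₁, hmin'⟩ := Set.exists_min_image _ f hfinB ⟨b₀, le_refl (f b₀)⟩
  have hmin : ∀ b, f b₁ ≤ f b := by
    intro b
    rcases le_total (f b) (f b₀) with h | h
    · exact hmin' b h
    · exact le_trans hb₁ h
  have key : ∀ b : Module.Basis (Fin 2) ℤ L, (∀ b', f b ≤ f b') → ‖b 0‖ ≤ ‖b 1‖ →
      IsMinkowskiBasis b := by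
    intro b hb hle
    refine ⟨hle, ?_⟩
    have hsh : ∀ m : ℤ, 0 ≤ 2 * (m : ℝ) * inner ℝ (b 0 : EuclideanSpace ℝ (Fin 2)) (b 1)
        + (m : ℝ) ^ 2 * ‖b 0‖ ^ 2 := by
      intro m
      obtain ⟨b', h0, h1⟩ := exists_shear b m
      have h := hb b'
      simp only [f, h0, h1] at h
      have he : ‖b 1 + m • b 0‖ ^ 2 = ‖b 1‖ ^ 2 +
          2 * (m : ℝ) * inner ℝ (b 0 : EuclideanSpace ℝ (Fin 2)) (b 1)
          + (m : ℝ) ^ 2 * ‖b 0‖ ^ 2 := by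
        have hc : ((b 1 + m • b 0 : L) : EuclideanSpace ℝ (Fin 2)) =
            (b 1 : EuclideanSpace ℝ (Fin 2)) + (m : ℝ) • (b 0 : EuclideanSpace ℝ (Fin 2)) := by
          simp [Int.cast_smul_eq_zsmul]
        rw [← Submodule.norm_coe, ← Submodule.norm_coe, ← Submodule.norm_coe, hc, norm_add_sq_real,
          inner_smul_right, norm_smul, mul_pow, Real.norm_eq_abs, sq_abs,
          real_inner_comm]
        ring
      linarith
    have h1 := hsh 1
    have h2 := hsh (-1)
    push_cast at h1 h2
    have := abs_le.mpr (⟨by linarith, by linarith⟩ :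
      -(‖b 0‖ ^ 2 / 2) ≤ inner ℝ (b 0 : EuclideanSpace ℝ (Fin 2)) (b 1) ∧
        inner ℝ (b 0 : EuclideanSpace ℝ (Fin 2)) (b 1) ≤ ‖b 0‖ ^ 2 / 2)
    linarith
  rcases le_total ‖b₁ 0‖ ‖b₁ 1‖ with h | h
  · exact ⟨b₁, key b₁ hmin h⟩
  · refine ⟨b₁.reindex (Equiv.swap 0 1), key _ ?_ (by simpa using h)⟩
    intro b'
    have := hmin b'
    simp only [f, Module.Basis.reindex_apply, Equiv.symm_swap, Equiv.swap_apply_left,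
      Equiv.swap_apply_right] at this ⊢
    linarith

/-- A Minkowski basis of the lattice `L`. -/
noncomputable def minkowskiBasis (L : Submodule ℤ (EuclideanSpace ℝ (Fin 2)))
    [DiscreteTopology L] [IsZLattice ℝ L] : Module.Basis (Fin 2) ℤ L :=
  (exists_isMinkowskiBasis L).choose

/-- `∑_{k,l ∈ ℤ} exp (-π α |(k + 1/2) v₁ + (l + 1/2) v₂|²)`. -/
noncomputable def centeredSum (v₁ v₂ : EuclideanSpace ℝ (Fin 2)) (α : ℝ) : ℝ :=
  ∑' p : ℤ × ℤ, Real.exp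
    (-Real.pi * α * ‖((p.1 : ℝ) + 1 / 2) • v₁ + ((p.2 : ℝ) + 1 / 2) • v₂‖ ^ 2)

/-- `∑_{k,l ∈ ℤ} (-1)^(k + l) exp (-π α |k v₁ + l v₂|²)`. -/
noncomputable def alternatingSum (v₁ v₂ : EuclideanSpace ℝ (Fin 2)) (α : ℝ) : ℝ :=
  ∑' p : ℤ × ℤ, (-1 : ℝ) ^ (p.1 + p.2) *
    Real.exp (-Real.pi * α * ‖(p.1 : ℝ) • v₁ + (p.2 : ℝ) • v₂‖ ^ 2)

/-- The centered lattice theta function of `L`: the sum over the lattice shifted by the center of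
the cell spanned by a Minkowski basis. -/
noncomputable def centeredTheta (L : Submodule ℤ (EuclideanSpace ℝ (Fin 2)))
    [DiscreteTopology L] [IsZLattice ℝ L] (α : ℝ) : ℝ :=
  centeredSum (minkowskiBasis L 0) (minkowskiBasis L 1) α

/-- The alternating lattice theta function of `L`: the signs alternate with respect to a
Minkowski basis. -/
noncomputable def alternatingTheta (L : Submodule ℤ (EuclideanSpace ℝ (Fin 2)))
    [DiscreteTopology L] [IsZLattice ℝ L] (α : ℝ) : ℝ :=
  alternatingSum (minkowskiBasis L 0) (minkowskiBasis L 1) α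

theorem norm_sq_comb (v₁ v₂ : EuclideanSpace ℝ (Fin 2)) (s t : ℝ) :
    ‖s • v₁ + t • v₂‖ ^ 2 = s ^ 2 * ‖v₁‖ ^ 2 + 2 * s * t * inner ℝ v₁ v₂ + t ^ 2 * ‖v₂‖ ^ 2 := by
  rw [norm_add_sq_real, inner_smul_left, inner_smul_right, norm_smul, norm_smul, mul_pow, mul_pow,
    Real.norm_eq_abs, Real.norm_eq_abs, sq_abs, sq_abs]
  simp only [conj_trivial]
  ring

/-- The centered sum in terms of the parameters `(x, y)` of the lattice. -/
theorem centeredSum_eq_param (v₁ v₂ : EuclideanSpace ℝ (Fin 2)) (α x y : ℝ)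
    (h₁ : ‖v₁‖ ^ 2 = 1 / y) (h₂ : inner ℝ v₁ v₂ = x / y) (h₃ : ‖v₂‖ ^ 2 = (x ^ 2 + y ^ 2) / y) :
    centeredSum v₁ v₂ α = ∑' p : ℤ × ℤ, Real.exp (-(Real.pi * α / y) *
      (((p.1 : ℝ) + 1 / 2) ^ 2 + 2 * x * ((p.1 : ℝ) + 1 / 2) * ((p.2 : ℝ) + 1 / 2) +
        (x ^ 2 + y ^ 2) * ((p.2 : ℝ) + 1 / 2) ^ 2)) := by
  unfold centeredSum
  congr 1
  ext p
  rw [norm_sq_comb, h₁, h₂, h₃]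
  congr 1
  ring

/-- The alternating sum in terms of the parameters `(x, y)` of the lattice. -/
theorem alternatingSum_eq_param (v₁ v₂ : EuclideanSpace ℝ (Fin 2)) (α x y : ℝ)
    (h₁ : ‖v₁‖ ^ 2 = 1 / y) (h₂ : inner ℝ v₁ v₂ = x / y) (h₃ : ‖v₂‖ ^ 2 = (x ^ 2 + y ^ 2) / y) :
    alternatingSum v₁ v₂ α = ∑' p : ℤ × ℤ, (-1 : ℝ) ^ (p.1 + p.2) *
      Real.exp (-(Real.pi * α / y) * ((p.1 : ℝ) ^ 2 + 2 * x * (p.1 : ℝ) * (p.2 : ℝ) +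
        (x ^ 2 + y ^ 2) * (p.2 : ℝ) ^ 2)) := by
  unfold alternatingSum
  congr 1
  ext p
  rw [norm_sq_comb, h₁, h₂, h₃]
  congr 2
  ring

theorem reduced_form_ge {A B C : ℝ} (hA : 0 ≤ A) (hAC : A ≤ C) (hB : 2 * |B| ≤ A) (k l : ℤ) :
    (k ≠ 0 ∨ l ≠ 0 → A ≤ (k : ℝ) ^ 2 * A + 2 * k * l * B + (l : ℝ) ^ 2 * C) ∧
    (l ≠ 0 → C ≤ (k : ℝ) ^ 2 * A + 2 * k * l * B + (l : ℝ) ^ 2 * C) := by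
  have h1 : -(|(k : ℝ)| * |(l : ℝ)| * A) ≤ 2 * k * l * B := by
    have h2 : |2 * (k : ℝ) * l * B| ≤ |(k : ℝ)| * |(l : ℝ)| * A := by
      rw [abs_mul, abs_mul, abs_mul, abs_two]
      nlinarith [mul_nonneg (abs_nonneg (k : ℝ)) (abs_nonneg (l : ℝ))]
    exact (abs_le.mp h2).1
  have h3 : k ≠ 0 ∨ l ≠ 0 → (1 : ℝ) ≤ (k : ℝ) ^ 2 - |(k : ℝ)| * |(l : ℝ)| + (l : ℝ) ^ 2 := by
    intro h
    have h4 : 1 ≤ |k| ^ 2 - |k| * |l| + |l| ^ 2 := by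
      have hk := abs_nonneg k
      have hl := abs_nonneg l
      rcases h with h | h
      · have := abs_pos.mpr h
        nlinarith [sq_nonneg (|k| - 2 * |l|)]
      · have := abs_pos.mpr h
        nlinarith [sq_nonneg (|l| - 2 * |k|)]
    have h5 : ((1 : ℤ) : ℝ) ≤ ((|k| ^ 2 - |k| * |l| + |l| ^ 2 : ℤ) : ℝ) := by exact_mod_cast h4
    push_cast at h5
    simpa [sq_abs] using h5
  constructor
  · intro h
    nlinarith [h3 h, mul_nonneg (sub_nonneg.mpr hAC) (sq_nonneg (l : ℝ))]
  · intro h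
    have h6 : (1 : ℝ) ≤ (l : ℝ) ^ 2 := by
      have h7 : (1 : ℤ) ≤ l ^ 2 := by
        have := sq_pos_of_ne_zero h
        omega
      exact_mod_cast h7
    nlinarith [h3 (Or.inr h), mul_nonneg (sub_nonneg.mpr hAC) (sub_nonneg.mpr h6)]

/-- Two bases of a lattice differ by an integer matrix of determinant `±1`. -/
theorem exists_change {L : Submodule ℤ (EuclideanSpace ℝ (Fin 2))}
    (b b' : Module.Basis (Fin 2) ℤ L) :
    ∃ p q r s : ℤ, (p * s - q * r) ^ 2 = 1 ∧
      (b' 0 : EuclideanSpace ℝ (Fin 2)) = (p : ℝ) • (b 0 : EuclideanSpace ℝ (Fin 2)) +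
        (q : ℝ) • (b 1 : EuclideanSpace ℝ (Fin 2)) ∧
      (b' 1 : EuclideanSpace ℝ (Fin 2)) = (r : ℝ) • (b 0 : EuclideanSpace ℝ (Fin 2)) +
        (s : ℝ) • (b 1 : EuclideanSpace ℝ (Fin 2)) := by
  refine ⟨b.repr (b' 0) 0, b.repr (b' 0) 1, b.repr (b' 1) 0, b.repr (b' 1) 1, ?_, ?_, ?_⟩
  · have h := Module.Basis.isUnit_det b b'
    rw [Module.Basis.det_apply, Matrix.det_fin_two, Int.isUnit_iff_abs_eq] at h
    simp only [Module.Basis.toMatrix_apply] at h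
    rw [← sq_abs]
    have h' : |b.repr (b' 0) 0 * b.repr (b' 1) 1 - b.repr (b' 0) 1 * b.repr (b' 1) 0| = 1 := by
      rw [← h]
      congr 1
      ring
    rw [h']
    norm_num
  · have h := congrArg Subtype.val (b.sum_repr (b' 0))
    rw [Fin.sum_univ_two] at h
    rw [← h]
    simp [Int.cast_smul_eq_zsmul]
  · have h := congrArg Subtype.val (b.sum_repr (b' 1))
    rw [Fin.sum_univ_two] at h
    rw [← h]
    simp [Int.cast_smul_eq_zsmul]

theorem IsMinkowskiBasis.le {L : Submodule ℤ (EuclideanSpace ℝ (Fin 2))}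
    {b b' : Module.Basis (Fin 2) ℤ L} (hb : IsMinkowskiBasis b) (hb' : IsMinkowskiBasis b') :
    ‖b 0‖ ^ 2 ≤ ‖b' 0‖ ^ 2 ∧ ‖b 1‖ ^ 2 ≤ ‖b' 1‖ ^ 2 := by
  obtain ⟨p, q, r, s, hdet, h0, h1⟩ := exists_change b b'
  have hA : ‖b 0‖ ^ 2 ≤ ‖b 1‖ ^ 2 := pow_le_pow_left₀ (norm_nonneg _) hb.norm_le 2
  have hA' : ‖b' 0‖ ^ 2 ≤ ‖b' 1‖ ^ 2 := pow_le_pow_left₀ (norm_nonneg _) hb'.norm_le 2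
  have e0 := reduced_form_ge (sq_nonneg _) hA hb.inner_le p q
  have e1 := reduced_form_ge (sq_nonneg _) hA hb.inner_le r s
  have n0 := norm_sq_comb (b 0) (b 1) p q
  have n1 := norm_sq_comb (b 0) (b 1) r s
  rw [← h0] at n0
  rw [← h1] at n1
  simp only [Submodule.norm_coe] at n0 n1
  rw [← n0] at e0
  rw [← n1] at e1
  have hpq : p ≠ 0 ∨ q ≠ 0 := by
    by_contra! h
    obtain ⟨rfl, rfl⟩ := h
    simp at hdet
  refine ⟨e0.1 hpq, ?_⟩
  by_cases hq : q = 0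
  · apply e1.2
    rintro rfl
    subst hq
    simp at hdet
  · exact le_trans (e0.2 hq) hA'

/-- All Minkowski bases of a lattice have the same Gram matrix up to the sign of its off-diagonal
entries. -/
theorem IsMinkowskiBasis.gram_eq {L : Submodule ℤ (EuclideanSpace ℝ (Fin 2))}
    {b b' : Module.Basis (Fin 2) ℤ L} (hb : IsMinkowskiBasis b) (hb' : IsMinkowskiBasis b') :
    ‖b' 0‖ ^ 2 = ‖b 0‖ ^ 2 ∧ ‖b' 1‖ ^ 2 = ‖b 1‖ ^ 2 ∧
    (inner ℝ (b' 0 : EuclideanSpace ℝ (Fin 2)) (b' 1) =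
        inner ℝ (b 0 : EuclideanSpace ℝ (Fin 2)) (b 1) ∨
      inner ℝ (b' 0 : EuclideanSpace ℝ (Fin 2)) (b' 1) =
        -inner ℝ (b 0 : EuclideanSpace ℝ (Fin 2)) (b 1)) := by
  have hA := le_antisymm (hb'.le hb).1 (hb.le hb').1
  have hC := le_antisymm (hb'.le hb).2 (hb.le hb').2
  refine ⟨hA, hC, ?_⟩
  rw [← sq_eq_sq_iff_eq_or_eq_neg]
  obtain ⟨p, q, r, s, hdet, h0, h1⟩ := exists_change b b'
  have n0 := norm_sq_comb (b 0) (b 1) p q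
  have n1 := norm_sq_comb (b 0) (b 1) r s
  have n2 : inner ℝ (b' 0 : EuclideanSpace ℝ (Fin 2)) (b' 1) = (p * r : ℝ) * ‖b 0‖ ^ 2 +
      (p * s + q * r : ℝ) * inner ℝ (b 0 : EuclideanSpace ℝ (Fin 2)) (b 1) +
      (q * s : ℝ) * ‖b 1‖ ^ 2 := by
    rw [h0, h1]
    simp only [inner_add_left, inner_add_right, inner_smul_left, inner_smul_right,
      real_inner_self_eq_norm_sq, conj_trivial, Submodule.norm_coe,
      real_inner_comm (b 0 : EuclideanSpace ℝ (Fin 2)) (b 1)]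
    ring
  rw [← h0] at n0
  rw [← h1] at n1
  simp only [Submodule.norm_coe] at n0 n1
  have hdetR : ((p : ℝ) * s - q * r) ^ 2 = 1 := by exact_mod_cast hdet
  have hd : ‖b' 0‖ ^ 2 * ‖b' 1‖ ^ 2 -
      inner ℝ (b' 0 : EuclideanSpace ℝ (Fin 2)) (b' 1) ^ 2 =
      ((p : ℝ) * s - q * r) ^ 2 * (‖b 0‖ ^ 2 * ‖b 1‖ ^ 2 -
      inner ℝ (b 0 : EuclideanSpace ℝ (Fin 2)) (b 1) ^ 2) := by
    rw [n0, n1, n2]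
    ring
  rw [hdetR, hA, hC] at hd
  linarith

/-- The centered theta function does not depend on the choice of the Minkowski basis. -/
theorem centeredTheta_eq (L : Submodule ℤ (EuclideanSpace ℝ (Fin 2)))
    [DiscreteTopology L] [IsZLattice ℝ L] (b : Module.Basis (Fin 2) ℤ L)
    (hb : IsMinkowskiBasis b) (α : ℝ) : centeredTheta L α = centeredSum (b 0) (b 1) α := by
  obtain ⟨hA, hC, hB⟩ := hb.gram_eq (exists_isMinkowskiBasis L).choose_spec
  unfold centeredTheta centeredSum minkowskiBasis
  simp only [norm_sq_comb, Submodule.norm_coe, hA, hC]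
  rcases hB with hB | hB
  · simp only [hB]
  · simp only [hB]
    let e : ℤ × ℤ ≃ ℤ × ℤ := (Equiv.refl ℤ).prodCongr (Equiv.subLeft (-1))
    rw [← e.tsum_eq]
    congr 1
    ext p
    simp only [e, Equiv.prodCongr_apply, Prod.map, Equiv.refl_apply, Equiv.subLeft_apply]
    congr 1
    push_cast
    ring

/-- The alternating theta function does not depend on the choice of the Minkowski basis. -/
theorem alternatingTheta_eq (L : Submodule ℤ (EuclideanSpace ℝ (Fin 2)))
    [DiscreteTopology L] [IsZLattice ℝ L] (b : Module.Basis (Fin 2) ℤ L)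
    (hb : IsMinkowskiBasis b) (α : ℝ) : alternatingTheta L α = alternatingSum (b 0) (b 1) α := by
  obtain ⟨hA, hC, hB⟩ := hb.gram_eq (exists_isMinkowskiBasis L).choose_spec
  unfold alternatingTheta alternatingSum minkowskiBasis
  simp only [norm_sq_comb, Submodule.norm_coe, hA, hC]
  rcases hB with hB | hB
  · simp only [hB]
  · simp only [hB]
    let e : ℤ × ℤ ≃ ℤ × ℤ := (Equiv.refl ℤ).prodCongr (Equiv.neg ℤ)
    rw [← e.tsum_eq]
    congr 1
    ext p
    simp only [e, Equiv.prodCongr_apply, Prod.map, Equiv.refl_apply, Equiv.neg_apply]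
    have hs : (-1 : ℝ) ^ (p.1 + -p.2) = (-1 : ℝ) ^ (p.1 + p.2) := by
      rw [zpow_add₀ (by norm_num), zpow_add₀ (by norm_num), zpow_neg, ← inv_zpow]
      norm_num
    rw [hs]
    congr 2
    push_cast
    ring

/-- The columns of the generating matrix of the hexagonal lattice of volume one. -/
noncomputable def hexVectors : Fin 2 → EuclideanSpace ℝ (Fin 2) :=
  ![Real.sqrt (2 / Real.sqrt 3) • !₂[1, 0],
    Real.sqrt (2 / Real.sqrt 3) • !₂[1 / 2, Real.sqrt 3 / 2]]

/-- The hexagonal lattice `A₂` of volume one. -/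
noncomputable def hexLattice : Submodule ℤ (EuclideanSpace ℝ (Fin 2)) :=
  Submodule.span ℤ (Set.range hexVectors)

theorem linearIndependent_hexVectors : LinearIndependent ℝ hexVectors := by
  unfold hexVectors
  rw [LinearIndependent.pair_iff]
  intro s t h
  have hc : Real.sqrt (2 / Real.sqrt 3) ≠ 0 := by positivity
  have h3 : Real.sqrt 3 ≠ 0 := by positivity
  have h0 := congrArg (fun v : EuclideanSpace ℝ (Fin 2) => v 0) h
  have h1 := congrArg (fun v : EuclideanSpace ℝ (Fin 2) => v 1) h
  simp at h0 h1
  subst h1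
  simpa [hc] using h0

/-- The columns of the generating matrix of the hexagonal lattice, as a basis of the plane. -/
noncomputable def hexBasis : Module.Basis (Fin 2) ℝ (EuclideanSpace ℝ (Fin 2)) :=
  basisOfLinearIndependentOfCardEqFinrank linearIndependent_hexVectors (by simp)

theorem hexLattice_eq : hexLattice = Submodule.span ℤ (Set.range hexBasis) := by
  rw [hexLattice, hexBasis, coe_basisOfLinearIndependentOfCardEqFinrank]

instance instDiscreteTopologyHexLattice : DiscreteTopology hexLattice := by
  rw [hexLattice_eq]
  infer_instance

instance instIsZLatticeHexLattice : IsZLattice ℝ hexLattice := by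
  simp only [hexLattice_eq]
  infer_instance

/-- `L` is a rotated version of `M`: `L = Q M` for some `Q ∈ SO(2, ℝ)`. -/
def IsRotationOf (L M : Submodule ℤ (EuclideanSpace ℝ (Fin 2))) : Prop :=
  ∃ Q ∈ Matrix.specialOrthogonalGroup (Fin 2) ℝ,
    (L : Set (EuclideanSpace ℝ (Fin 2))) =
      (fun v => Matrix.toEuclideanLin Q v) '' (M : Set (EuclideanSpace ℝ (Fin 2)))

/-!
Let `(v₁, v₂)` be a Minkowski basis of a lattice of volume one, and put `y = 1 / |v₁|²` and
`x = y ⟨v₁, v₂⟩`, so that `|x| ≤ 1 / 2` and `x² + y² ≥ 1`; the hexagonal lattice is the point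
`(1 / 2, √3 / 2)`. Poisson summation in the direction of `v₁` turns both theta functions into the
same kind of cosine series in `x` (`alternating_eq_mixedTheta`, `centered_eq_mixedTheta`), and a
comparison of the two series gives `θᶜ(α) = θ^±(1 / α) / α`. So it suffices to show that the
alternating theta function, `alternatingParam β x y`, has its maximum at the hexagonal point for
every `β > 0`. This is done by two monotonicity statements, along horizontal lines and then along
the line `x = 1 / 2`.

*Along horizontal lines* (`mixedTheta_lt`). The series is `mixedTheta a b x` with
`a b = y² ≥ 3 / 4`, so at least one of `a`, `b` is at least `√3 / 2`. In the difference of the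
values at `1 / 2` and at `x`, every term is at most its weight times a multiple of its frequency
times the sine of `π (1 - 2 x) / 4`, and the terms of lowest frequency in the variable with the
rapidly decaying weight dominate. They form a one-dimensional theta function (`oddRow` or
`intRow`). It is bounded from below by a multiple of the same sine: directly if the other parameter
is not small, and otherwise on the Gaussian side of the Poisson summation formula.

*Along the line `x = 1 / 2`* (`thetaFour_mul_lt`). Half of the cosines vanish there, and what
remains is the product `θ₄(β / y) θ₄(4 β y)` of theta constants (`alternatingParam_half`). By
Gauss's identity `θ₄ = ∏ (1 - q^k) / (1 + q^k)` with `q = exp (-π s)`, which is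
`∏ tanh (π k s / 2)`, this is a product of functions `tanh (c / y) tanh (4 c y)`, each of which
decreases strictly for `y ≥ 1 / 2`, because `sinh w / w` increases. Gauss's identity follows from
a finite identity of Shanks (`gaussProd_eq_sum`).

Since all these inequalities are strict, equality forces `|x| = 1 / 2` and `y = √3 / 2`, that is, a
hexagonal Gram matrix up to the sign of `⟨v₁, v₂⟩`, and such a lattice is a rotation of `A₂`
(`isRotationOf_hexLattice`).
-/

/-! ### Poisson summation for shifted Gaussians -/

theorem summable_exp_int_add_sq {c : ℝ} (hc : 0 < c) (z : ℝ) :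
    Summable fun k : ℤ => Real.exp (-Real.pi * c * (k + z) ^ 2) := by
  refine (HurwitzZeta.hasSum_int_evenKernel z hc).summable.congr fun k => ?_
  ring_nf

theorem summable_exp_nat_add_sq {c : ℝ} (hc : 0 < c) (z : ℝ) :
    Summable fun k : ℕ => Real.exp (-Real.pi * c * (k + z) ^ 2) := by
  refine ((summable_exp_int_add_sq hc z).comp_injective Nat.cast_injective).congr fun k => ?_
  simp

/-- Poisson summation for a Gaussian shifted by `u` and twisted by the character of parameter
`ε`. -/
theorem tsum_twisted_gaussian {t : ℝ} (ht : 0 < t) (ε u : ℝ) :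
    ∑' k : ℤ, Complex.exp (2 * Real.pi * Complex.I * ε * k - Real.pi / t * (k + u) ^ 2) =
      Real.sqrt t * ∑' n : ℤ, Complex.exp (-Real.pi * t * (n - ε) ^ 2 +
        2 * Real.pi * Complex.I * (n - ε) * u) := by
  have ht' : (t : ℂ) ≠ 0 := by exact_mod_cast ht.ne'
  have ha : 0 < ((1 / t : ℝ) : ℂ).re := by rw [Complex.ofReal_re]; positivity
  have h := Complex.tsum_exp_neg_quadratic ha (-(u : ℂ) / t + Complex.I * ε)
  have e1 : ∀ k : ℤ, Complex.exp (-Real.pi * ((1 / t : ℝ) : ℂ) * k ^ 2 +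
      2 * Real.pi * (-(u : ℂ) / t + Complex.I * ε) * k) = Complex.exp (Real.pi * u ^ 2 / t) *
      Complex.exp (2 * Real.pi * Complex.I * ε * k - Real.pi / t * (k + u) ^ 2) := by
    intro k
    rw [← Complex.exp_add]
    congr 1
    push_cast
    field_simp
    ring
  have e2 : ∀ n : ℤ, Complex.exp (-Real.pi / ((1 / t : ℝ) : ℂ) *
      (n + Complex.I * (-(u : ℂ) / t + Complex.I * ε)) ^ 2) =
      Complex.exp (Real.pi * u ^ 2 / t) * Complex.exp (-Real.pi * t * (n - ε) ^ 2 +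
        2 * Real.pi * Complex.I * (n - ε) * u) := by
    intro n
    rw [← Complex.exp_add]
    congr 1
    push_cast
    have e3 : (n + Complex.I * (-(u : ℂ) / t + Complex.I * ε)) =
        (n - ε) - Complex.I * u / t := by
      linear_combination (ε : ℂ) * Complex.I_mul_I
    rw [e3]
    field_simp
    linear_combination (-(u : ℂ) ^ 2) * Complex.I_sq
  have e4 : (1 : ℂ) / ((1 / t : ℝ) : ℂ) ^ (1 / 2 : ℂ) = Real.sqrt t := by
    rw [show (1 / 2 : ℂ) = ((1 / 2 : ℝ) : ℂ) by push_cast; rfl,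
      ← Complex.ofReal_cpow (by positivity), ← Real.sqrt_eq_rpow]
    rw [Real.sqrt_div zero_le_one]
    push_cast
    simp
  simp_rw [e1, e2, tsum_mul_left, e4] at h
  have h0 : Complex.exp (Real.pi * u ^ 2 / t) ≠ 0 := Complex.exp_ne_zero _
  apply mul_left_cancel₀ h0
  rw [h]
  ring

theorem norm_twisted_gaussian (t ε u : ℝ) (n : ℤ) :
    ‖Complex.exp (-Real.pi * t * (n - ε) ^ 2 + 2 * Real.pi * Complex.I * (n - ε) * u)‖ =
      Real.exp (-Real.pi * t * (n + -ε) ^ 2) := by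
  rw [Complex.norm_exp]
  congr 1
  have : (-Real.pi * t * (n - ε) ^ 2 + 2 * Real.pi * Complex.I * (n - ε) * u : ℂ) =
      ((-Real.pi * t * (n + -ε) ^ 2 : ℝ) : ℂ) + ((2 * Real.pi * (n - ε) * u : ℝ) : ℂ) *
        Complex.I := by
    push_cast
    ring
  rw [this, Complex.add_re, Complex.ofReal_re, Complex.re_ofReal_mul, Complex.I_re]
  ring

theorem summable_twisted_gaussian {t : ℝ} (ht : 0 < t) (ε u : ℝ) :
    Summable fun n : ℤ => Complex.exp (-Real.pi * t * (n - ε) ^ 2 +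
      2 * Real.pi * Complex.I * (n - ε) * u) := by
  apply Summable.of_norm
  simp_rw [norm_twisted_gaussian]
  exact summable_exp_int_add_sq ht _

theorem exp_add_exp_conj (r θ : ℝ) (v w : ℂ) (hv : v = (r : ℂ) + θ * Complex.I)
    (hw : w = (r : ℂ) - θ * Complex.I) :
    Complex.exp v + Complex.exp w = ((2 * (Real.exp r * Real.cos θ) : ℝ) : ℂ) := by
  rw [hv, hw, Complex.exp_add, sub_eq_add_neg, Complex.exp_add]
  push_cast
  rw [Complex.cos]
  ring_nf

/-- The alternating sum of a shifted Gaussian as a cosine series in odd frequencies. -/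
theorem hasSum_alternating_gaussian {t : ℝ} (ht : 0 < t) (z : ℝ) :
    HasSum (fun k : ℤ => (-1 : ℝ) ^ k * Real.exp (-Real.pi / t * (k + z) ^ 2))
      (2 * Real.sqrt t * ∑' l : ℕ, Real.exp (-Real.pi * t * (l + 1 / 2) ^ 2) *
        Real.cos (Real.pi * (2 * l + 1) * z)) := by
  have hs : Summable fun k : ℤ => (-1 : ℝ) ^ k * Real.exp (-Real.pi / t * (k + z) ^ 2) := by
    refine Summable.of_norm_bounded (summable_exp_int_add_sq (c := 1 / t) (by positivity) z) ?_
    intro k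
    rw [norm_mul, norm_zpow, norm_neg, norm_one, one_zpow, one_mul, Real.norm_eq_abs,
      Real.abs_exp]
    apply le_of_eq
    ring_nf
  convert hs.hasSum using 1
  have h := tsum_twisted_gaussian ht (-1 / 2) z
  have e1 : ∀ k : ℤ, Complex.exp (2 * Real.pi * Complex.I * ((-1 / 2 : ℝ) : ℂ) * k -
      Real.pi / t * (k + z) ^ 2) =
      (((-1 : ℝ) ^ k * Real.exp (-Real.pi / t * (k + z) ^ 2) : ℝ) : ℂ) := by
    intro k
    rw [show (2 * Real.pi * Complex.I * ((-1 / 2 : ℝ) : ℂ) * k -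
      Real.pi / t * (k + z) ^ 2 : ℂ) = (k : ℂ) * (-(Real.pi * Complex.I)) +
      ((-Real.pi / t * (k + z) ^ 2 : ℝ) : ℂ) by push_cast; ring, Complex.exp_add,
      Complex.exp_int_mul, Complex.exp_neg, Complex.exp_pi_mul_I]
    push_cast
    congr 2
    norm_num
  simp_rw [e1] at h
  rw [← Complex.ofReal_tsum] at h
  have hsum := summable_twisted_gaussian ht (-1 / 2) z
  set f : ℤ → ℂ := fun n => Complex.exp (-Real.pi * t * (n - ((-1 / 2 : ℝ) : ℂ)) ^ 2 +
      2 * Real.pi * Complex.I * (n - ((-1 / 2 : ℝ) : ℂ)) * z) with hf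
  have s1 : Summable fun n : ℕ => f n := hsum.comp_injective Nat.cast_injective
  have s2 : Summable fun n : ℕ => f (-((n : ℤ) + 1)) :=
    hsum.comp_injective (i := fun n : ℕ => -((n : ℤ) + 1)) (fun a b hab => by simpa using hab)
  have h2 := HasSum.of_nat_of_neg_add_one s1.hasSum s2.hasSum
  have h3 := s1.hasSum.add s2.hasSum
  have e2 : ∀ l : ℕ, f l + f (-((l : ℤ) + 1)) = ((2 * (Real.exp (-Real.pi * t * (l + 1 / 2) ^ 2) *
      Real.cos (Real.pi * (2 * l + 1) * z)) : ℝ) : ℂ) := by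
    intro l
    apply exp_add_exp_conj <;>
    · push_cast
      ring
  simp_rw [e2] at h3
  have h4 := h3.tsum_eq
  rw [← Complex.ofReal_tsum, tsum_mul_left] at h4
  have h5 := h2.tsum_eq
  rw [h5, ← h4] at h
  have h6 : ((∑' k : ℤ, (-1 : ℝ) ^ k * Real.exp (-Real.pi / t * (k + z) ^ 2) : ℝ) : ℂ) =
    ((Real.sqrt t * (2 * ∑' l : ℕ, Real.exp (-Real.pi * t * (l + 1 / 2) ^ 2) *
      Real.cos (Real.pi * (2 * l + 1) * z)) : ℝ) : ℂ) := by
    rw [h]; push_cast; ring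
  rw [Complex.ofReal_injective h6]
  ring

/-- The sum of a Gaussian over the half-integers shifted by `z` as an alternating cosine series. -/
theorem hasSum_centered_gaussian {t : ℝ} (ht : 0 < t) (z : ℝ) :
    HasSum (fun k : ℤ => Real.exp (-Real.pi / t * (k + 1 / 2 + z) ^ 2))
      (Real.sqrt t * (1 + 2 * ∑' n : ℕ, (-1 : ℝ) ^ (n + 1) *
        Real.exp (-Real.pi * t * (n + 1) ^ 2) * Real.cos (2 * Real.pi * (n + 1) * z))) := by
  have hs : Summable fun k : ℤ => Real.exp (-Real.pi / t * (k + 1 / 2 + z) ^ 2) := by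
    refine (summable_exp_int_add_sq (c := 1 / t) (by positivity) (1 / 2 + z)).congr fun k => ?_
    ring_nf
  convert hs.hasSum using 1
  have h := tsum_twisted_gaussian ht 0 (1 / 2 + z)
  have e1 : ∀ k : ℤ, Complex.exp (2 * Real.pi * Complex.I * ((0 : ℝ) : ℂ) * k -
      Real.pi / t * (k + ((1 / 2 + z : ℝ) : ℂ)) ^ 2) =
      ((Real.exp (-Real.pi / t * (k + 1 / 2 + z) ^ 2) : ℝ) : ℂ) := by
    intro k
    push_cast
    congr 1
    ring
  simp_rw [e1] at h
  rw [← Complex.ofReal_tsum] at h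
  have hsum := summable_twisted_gaussian ht 0 (1 / 2 + z)
  set f : ℤ → ℂ := fun n => Complex.exp (-Real.pi * t * (n - ((0 : ℝ) : ℂ)) ^ 2 +
      2 * Real.pi * Complex.I * (n - ((0 : ℝ) : ℂ)) * ((1 / 2 + z : ℝ) : ℂ)) with hf
  have s1 : Summable fun n : ℕ => f ((n : ℤ) + 1) :=
    hsum.comp_injective (i := fun n : ℕ => (n : ℤ) + 1) (fun a b hab => by simpa using hab)
  have s2 : Summable fun n : ℕ => f (-((n : ℤ) + 1)) :=
    hsum.comp_injective (i := fun n : ℕ => -((n : ℤ) + 1)) (fun a b hab => by simpa using hab)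
  have h2 := HasSum.of_add_one_of_neg_add_one s1.hasSum s2.hasSum
  have h3 := s1.hasSum.add s2.hasSum
  have e2 : ∀ n : ℕ, f ((n : ℤ) + 1) + f (-((n : ℤ) + 1)) =
      ((2 * ((-1 : ℝ) ^ (n + 1) * Real.exp (-Real.pi * t * (n + 1) ^ 2) *
        Real.cos (2 * Real.pi * (n + 1) * z)) : ℝ) : ℂ) := by
    intro n
    have hc : Real.cos (2 * Real.pi * (n + 1) * (1 / 2 + z)) =
        (-1 : ℝ) ^ (n + 1) * Real.cos (2 * Real.pi * (n + 1) * z) := by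
      rw [← Real.cos_add_nat_mul_pi]
      congr 1
      push_cast
      ring
    rw [show (2 * ((-1 : ℝ) ^ (n + 1) * Real.exp (-Real.pi * t * (n + 1) ^ 2) *
        Real.cos (2 * Real.pi * (n + 1) * z)) : ℝ) = 2 * (Real.exp (-Real.pi * t * (n + 1) ^ 2) *
        Real.cos (2 * Real.pi * (n + 1) * (1 / 2 + z))) by rw [hc]; ring]
    apply exp_add_exp_conj <;>
    · push_cast
      ring
  simp_rw [e2] at h3
  have h4 := h3.tsum_eq
  rw [← Complex.ofReal_tsum, tsum_mul_left] at h4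
  have h5 := h2.tsum_eq
  have h0 : f 0 = 1 := by simp [hf]
  rw [h5, h0, add_right_comm, ← h4] at h
  have h6 : ((∑' k : ℤ, Real.exp (-Real.pi / t * (k + 1 / 2 + z) ^ 2) : ℝ) : ℂ) =
    ((Real.sqrt t * (1 + 2 * ∑' n : ℕ, (-1 : ℝ) ^ (n + 1) *
        Real.exp (-Real.pi * t * (n + 1) ^ 2) * Real.cos (2 * Real.pi * (n + 1) * z)) : ℝ) : ℂ) := by
    rw [h]; push_cast; ring
  exact (Complex.ofReal_injective h6).symm

/-! ### Lattice sums as cosine series in the parameter `x` -/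

/-- `∑_{l ≥ 0} exp (-π b (l + 1/2)²)`, one half of the Jacobi theta constant `θ₂` at
`q = exp (-π b)`. -/
noncomputable def halfTheta (b : ℝ) : ℝ := ∑' l : ℕ, Real.exp (-Real.pi * b * (l + 1 / 2) ^ 2)

/-- The term of `mixedTheta a b x` of frequency `(n + 1) (2 l + 1) / 2`, where `p = (n, l)`. -/
noncomputable def mixedTerm (a b x : ℝ) (p : ℕ × ℕ) : ℝ :=
  (-1) ^ (p.1 + 1) * Real.exp (-Real.pi * a * (p.1 + 1) ^ 2) *
    Real.exp (-Real.pi * b * (p.2 + 1 / 2) ^ 2) *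
      Real.cos (Real.pi * (p.1 + 1) * (2 * p.2 + 1) * x)

/-- The cosine series `∑ (-1)^m exp (-π a m² - π b h²) cos (2 π m h x)` over positive integers `m`
and positive half-integers `h`. Up to elementary factors it is the part of both the centered and
the alternating theta function that depends on `x`. -/
noncomputable def mixedTheta (a b x : ℝ) : ℝ := ∑' p : ℕ × ℕ, mixedTerm a b x p

theorem summable_swap {ι κ : Type*} {f : ι × κ → ℝ} (h : Summable f) :
    Summable fun p : κ × ι => f (p.2, p.1) :=
  (Equiv.prodComm κ ι).summable_iff.mpr h

theorem tsum_prod_swap {ι κ : Type*} {f : ι × κ → ℝ} (h : Summable f) :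
    ∑' p, f p = ∑' l : κ, ∑' k : ι, f (k, l) := by
  rw [← (Equiv.prodComm κ ι).tsum_eq, ← Summable.tsum_prod (summable_swap h)]
  rfl

theorem summable_mixedBound {a b : ℝ} (ha : 0 < a) (hb : 0 < b) :
    Summable fun p : ℕ × ℕ => Real.exp (-Real.pi * a * (p.1 + 1) ^ 2) *
      Real.exp (-Real.pi * b * (p.2 + 1 / 2) ^ 2) :=
  (summable_exp_nat_add_sq ha 1).mul_of_nonneg (summable_exp_nat_add_sq hb (1 / 2))
    (fun _ => (Real.exp_pos _).le) (fun _ => (Real.exp_pos _).le)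

theorem summable_mixedTerm {a b : ℝ} (ha : 0 < a) (hb : 0 < b) (x : ℝ) :
    Summable (mixedTerm a b x) := by
  refine Summable.of_norm_bounded (summable_mixedBound ha hb) fun p => ?_
  rw [mixedTerm, norm_mul, norm_mul, norm_mul, norm_pow, norm_neg, norm_one, one_pow, one_mul]
  simp only [Real.norm_eq_abs, Real.abs_exp]
  exact mul_le_of_le_one_right (by positivity) (Real.abs_cos_le_one _)

theorem mixedTheta_neg (a b x : ℝ) : mixedTheta a b (-x) = mixedTheta a b x := by
  simp [mixedTheta, mixedTerm]

theorem mixedTheta_abs (a b x : ℝ) : mixedTheta a b |x| = mixedTheta a b x := by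
  rcases abs_choice x with h | h <;> rw [h]
  exact mixedTheta_neg a b x

theorem half_sq_add_sq_le {x y : ℝ} (hx : |x| ≤ 1 / 2) (hxy : 1 ≤ x ^ 2 + y ^ 2) (s t : ℝ) :
    (s ^ 2 + t ^ 2) / 2 ≤ s ^ 2 + 2 * x * s * t + (x ^ 2 + y ^ 2) * t ^ 2 := by
  have h1 : |x * (s * t)| ≤ 1 / 2 * |s * t| := by
    rw [abs_mul]; gcongr
  have h2 : |s * t| ≤ (s ^ 2 + t ^ 2) / 2 := by
    rw [abs_le]
    constructor <;> nlinarith [sq_nonneg (s + t), sq_nonneg (s - t)]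
  have h3 := (abs_le.mp h1).1
  nlinarith [mul_nonneg (sub_nonneg.mpr hxy) (sq_nonneg t)]

theorem summable_exp_form {x y c : ℝ} (hx : |x| ≤ 1 / 2) (hxy : 1 ≤ x ^ 2 + y ^ 2) (hc : 0 < c)
    (d : ℝ) :
    Summable fun p : ℤ × ℤ => Real.exp (-(Real.pi * c) * (((p.1 : ℝ) + d) ^ 2 +
      2 * x * ((p.1 : ℝ) + d) * ((p.2 : ℝ) + d) + (x ^ 2 + y ^ 2) * ((p.2 : ℝ) + d) ^ 2)) := by
  have h := (summable_exp_int_add_sq (c := c / 2) (by positivity) d)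
  refine Summable.of_nonneg_of_le (fun _ => (Real.exp_pos _).le) (fun p => ?_)
    (h.mul_of_nonneg h (fun _ => (Real.exp_pos _).le) (fun _ => (Real.exp_pos _).le))
  rw [← Real.exp_add, Real.exp_le_exp]
  nlinarith [mul_le_mul_of_nonneg_left (half_sq_add_sq_le hx hxy ((p.1 : ℝ) + d) ((p.2 : ℝ) + d))
    (by positivity : 0 ≤ Real.pi * c)]

/-- The alternating lattice sum as a cosine series in `x`, by Poisson summation along the first
basis vector. -/
theorem alternating_eq_mixedTheta {β x y : ℝ} (hβ : 0 < β) (hy : 0 < y) (hx : |x| ≤ 1 / 2)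
    (hxy : 1 ≤ x ^ 2 + y ^ 2) :
    ∑' p : ℤ × ℤ, (-1 : ℝ) ^ (p.1 + p.2) *
      Real.exp (-(Real.pi * β / y) * ((p.1 : ℝ) ^ 2 + 2 * x * (p.1 : ℝ) * (p.2 : ℝ) +
        (x ^ 2 + y ^ 2) * (p.2 : ℝ) ^ 2)) =
      2 * Real.sqrt (y / β) * (halfTheta (y / β) + 2 * mixedTheta (β * y) (y / β) x) := by
  have ht : 0 < y / β := by positivity
  have hs : Summable fun p : ℤ × ℤ => (-1 : ℝ) ^ (p.1 + p.2) *
      Real.exp (-(Real.pi * β / y) * ((p.1 : ℝ) ^ 2 + 2 * x * (p.1 : ℝ) * (p.2 : ℝ) +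
        (x ^ 2 + y ^ 2) * (p.2 : ℝ) ^ 2)) := by
    refine Summable.of_norm_bounded (summable_exp_form hx hxy (c := β / y) (by positivity) 0) ?_
    intro p
    rw [norm_mul, norm_zpow, norm_neg, norm_one, one_zpow, one_mul, Real.norm_eq_abs,
      Real.abs_exp]
    apply le_of_eq
    simp only [add_zero]
    ring_nf
  rw [tsum_prod_swap hs]
  have hrow := (summable_swap hs).prod
  have e1 : ∀ l : ℤ, ∑' k : ℤ, (-1 : ℝ) ^ (k + l) *
      Real.exp (-(Real.pi * β / y) * ((k : ℝ) ^ 2 + 2 * x * (k : ℝ) * (l : ℝ) +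
        (x ^ 2 + y ^ 2) * (l : ℝ) ^ 2)) =
      (-1 : ℝ) ^ l * Real.exp (-Real.pi * (β * y) * (l : ℝ) ^ 2) *
      (2 * Real.sqrt (y / β) * ∑' j : ℕ, Real.exp (-Real.pi * (y / β) * (j + 1 / 2) ^ 2) *
        Real.cos (Real.pi * (2 * j + 1) * (l * x))) := by
    intro l
    rw [← (hasSum_alternating_gaussian ht (l * x)).tsum_eq, ← tsum_mul_left]
    congr 1
    ext k
    rw [zpow_add₀ (by norm_num)]
    have : Real.exp (-(Real.pi * β / y) * ((k : ℝ) ^ 2 + 2 * x * (k : ℝ) * (l : ℝ) +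
        (x ^ 2 + y ^ 2) * (l : ℝ) ^ 2)) = Real.exp (-Real.pi * (β * y) * (l : ℝ) ^ 2) *
        Real.exp (-Real.pi / (y / β) * (k + l * x) ^ 2) := by
      rw [← Real.exp_add]
      congr 1
      field_simp
      ring
    rw [this]
    ring
  simp_rw [e1] at hrow ⊢
  set f : ℤ → ℝ := fun l => (-1 : ℝ) ^ l * Real.exp (-Real.pi * (β * y) * (l : ℝ) ^ 2) *
      (2 * Real.sqrt (y / β) * ∑' j : ℕ, Real.exp (-Real.pi * (y / β) * (j + 1 / 2) ^ 2) *
        Real.cos (Real.pi * (2 * j + 1) * (l * x))) with hf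
  have s1 : Summable fun n : ℕ => f ((n : ℤ) + 1) :=
    hrow.comp_injective (i := fun n : ℕ => (n : ℤ) + 1) (fun a b hab => by simpa using hab)
  have e2 : ∀ n : ℕ, f (-((n : ℤ) + 1)) = f ((n : ℤ) + 1) := by
    intro n
    simp only [hf]
    rw [zpow_neg, ← inv_zpow, show ((-1 : ℝ))⁻¹ = -1 by norm_num]
    push_cast
    rw [neg_sq]
    simp only [neg_mul, mul_neg, Real.cos_neg]
  have s2 : Summable fun n : ℕ => f (-((n : ℤ) + 1)) := by simp_rw [e2]; exact s1
  have h2 := (HasSum.of_add_one_of_neg_add_one s1.hasSum s2.hasSum).tsum_eq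
  rw [h2]
  simp_rw [e2]
  have h0 : f 0 = 2 * Real.sqrt (y / β) * halfTheta (y / β) := by
    simp [hf, halfTheta]
  rw [h0, mixedTheta, Summable.tsum_prod (summable_mixedTerm (by positivity) ht x)]
  have e3 : ∀ n : ℕ, f ((n : ℤ) + 1) = 2 * Real.sqrt (y / β) *
      ∑' l : ℕ, mixedTerm (β * y) (y / β) x (n, l) := by
    intro n
    simp only [hf, mixedTerm]
    rw [mul_left_comm, ← tsum_mul_left]
    congr 2
    ext j
    rw [show ((n : ℤ) + 1) = ((n + 1 : ℕ) : ℤ) by push_cast; rfl, zpow_natCast]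
    push_cast
    rw [show Real.pi * (2 * (j : ℝ) + 1) * ((n + 1) * x) = Real.pi * (n + 1) * (2 * j + 1) * x
      by ring]
    ring
  simp_rw [e3, tsum_mul_left]
  ring

/-- The centered lattice sum as a cosine series in `x`, by Poisson summation along the first basis
vector. -/
theorem centered_eq_mixedTheta {α x y : ℝ} (hα : 0 < α) (hy : 0 < y) (hx : |x| ≤ 1 / 2)
    (hxy : 1 ≤ x ^ 2 + y ^ 2) :
    ∑' p : ℤ × ℤ, Real.exp (-(Real.pi * α / y) *
      (((p.1 : ℝ) + 1 / 2) ^ 2 + 2 * x * ((p.1 : ℝ) + 1 / 2) * ((p.2 : ℝ) + 1 / 2) +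
        (x ^ 2 + y ^ 2) * ((p.2 : ℝ) + 1 / 2) ^ 2)) =
      2 * Real.sqrt (y / α) * (halfTheta (α * y) + 2 * mixedTheta (y / α) (α * y) x) := by
  have ht : 0 < y / α := by positivity
  have hb : 0 < α * y := by positivity
  have hs : Summable fun p : ℤ × ℤ => Real.exp (-(Real.pi * α / y) *
      (((p.1 : ℝ) + 1 / 2) ^ 2 + 2 * x * ((p.1 : ℝ) + 1 / 2) * ((p.2 : ℝ) + 1 / 2) +
        (x ^ 2 + y ^ 2) * ((p.2 : ℝ) + 1 / 2) ^ 2)) := by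
    refine (summable_exp_form hx hxy (c := α / y) (by positivity) (1 / 2)).congr fun p => ?_
    rw [mul_div_assoc]
  rw [tsum_prod_swap hs]
  have hrow := (summable_swap hs).prod
  have e1 : ∀ l : ℤ, ∑' k : ℤ, Real.exp (-(Real.pi * α / y) *
      (((k : ℝ) + 1 / 2) ^ 2 + 2 * x * ((k : ℝ) + 1 / 2) * ((l : ℝ) + 1 / 2) +
        (x ^ 2 + y ^ 2) * ((l : ℝ) + 1 / 2) ^ 2)) =
      Real.exp (-Real.pi * (α * y) * ((l : ℝ) + 1 / 2) ^ 2) *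
      (Real.sqrt (y / α) * (1 + 2 * ∑' n : ℕ, (-1 : ℝ) ^ (n + 1) *
        Real.exp (-Real.pi * (y / α) * (n + 1) ^ 2) *
          Real.cos (2 * Real.pi * (n + 1) * (((l : ℝ) + 1 / 2) * x)))) := by
    intro l
    rw [← (hasSum_centered_gaussian ht (((l : ℝ) + 1 / 2) * x)).tsum_eq, ← tsum_mul_left]
    congr 1
    ext k
    rw [← Real.exp_add]
    congr 1
    field_simp
    ring
  simp_rw [e1] at hrow ⊢
  set f : ℤ → ℝ := fun l => Real.exp (-Real.pi * (α * y) * ((l : ℝ) + 1 / 2) ^ 2) *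
      (Real.sqrt (y / α) * (1 + 2 * ∑' n : ℕ, (-1 : ℝ) ^ (n + 1) *
        Real.exp (-Real.pi * (y / α) * (n + 1) ^ 2) *
          Real.cos (2 * Real.pi * (n + 1) * (((l : ℝ) + 1 / 2) * x)))) with hf
  have s1 : Summable fun n : ℕ => f (n : ℤ) := hrow.comp_injective Nat.cast_injective
  have e2 : ∀ n : ℕ, f (-((n : ℤ) + 1)) = f (n : ℤ) := by
    intro n
    simp only [hf]
    push_cast
    rw [show (-((n : ℝ) + 1) + 1 / 2) = -((n : ℝ) + 1 / 2) by ring, neg_sq]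
    simp only [neg_mul, mul_neg, Real.cos_neg]
  have s2 : Summable fun n : ℕ => f (-((n : ℤ) + 1)) := by simp_rw [e2]; exact s1
  have h2 := (HasSum.of_nat_of_neg_add_one s1.hasSum s2.hasSum).tsum_eq
  rw [h2]
  simp_rw [e2]
  have hm := summable_mixedTerm ht hb x
  have hmt := tsum_prod_swap hm
  have hmr := (summable_swap hm).prod
  have e3 : ∀ l : ℕ, f (l : ℤ) = Real.sqrt (y / α) *
      (Real.exp (-Real.pi * (α * y) * ((l : ℝ) + 1 / 2) ^ 2) +
        2 * ∑' n : ℕ, mixedTerm (y / α) (α * y) x (n, l)) := by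
    intro l
    simp only [hf, mixedTerm]
    rw [mul_left_comm, mul_add, mul_one, mul_left_comm _ (2 : ℝ), ← tsum_mul_left]
    congr 4
    ext n
    push_cast
    rw [show 2 * Real.pi * ((n : ℝ) + 1) * (((l : ℝ) + 1 / 2) * x) =
      Real.pi * (n + 1) * (2 * l + 1) * x by ring]
    ring
  simp_rw [e3, tsum_mul_left]
  rw [Summable.tsum_add (summable_exp_nat_add_sq hb (1 / 2)) (hmr.mul_left 2), tsum_mul_left,
    mixedTheta, hmt, halfTheta]
  ring

/-! ### Gauss's product for the theta constant `θ₄` -/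

/-- The theta constant `θ₄ = ∑_{n ∈ ℤ} (-1)^n q^(n²)` at the nome `q = exp (-π s)`. -/
noncomputable def thetaFour (s : ℝ) : ℝ :=
  1 + 2 * ∑' n : ℕ, (-1 : ℝ) ^ (n + 1) * Real.exp (-Real.pi * s * (n + 1) ^ 2)

/-- The partial products `∏_{k = 1}^n (1 - q^k) / (1 + q^k)` of Gauss's product. -/
noncomputable def gaussProd (q : ℝ) (n : ℕ) : ℝ :=
  ∏ k ∈ Finset.range n, (1 - q ^ (k + 1)) / (1 + q ^ (k + 1))

theorem gaussProd_succ (q : ℝ) (n : ℕ) :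
    gaussProd q (n + 1) = gaussProd q n * ((1 - q ^ (n + 1)) / (1 + q ^ (n + 1))) :=
  Finset.prod_range_succ _ _

theorem gaussFactor_pos {q : ℝ} (h0 : 0 < q) (h1 : q < 1) (k : ℕ) :
    0 < (1 - q ^ (k + 1)) / (1 + q ^ (k + 1)) := by
  have : q ^ (k + 1) < 1 := pow_lt_one₀ h0.le h1 (Nat.succ_ne_zero k)
  exact div_pos (by linarith) (by positivity)

theorem gaussProd_pos {q : ℝ} (h0 : 0 < q) (h1 : q < 1) (n : ℕ) : 0 < gaussProd q n :=
  Finset.prod_pos fun k _ => gaussFactor_pos h0 h1 k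

theorem gaussProd_antitone {q : ℝ} (h0 : 0 < q) (h1 : q < 1) : Antitone (gaussProd q) := by
  refine antitone_nat_of_succ_le fun n => ?_
  rw [gaussProd_succ]
  refine mul_le_of_le_one_right (gaussProd_pos h0 h1 n).le ?_
  rw [div_le_one (by positivity)]
  linarith [pow_pos h0 (n + 1)]

/-- Shanks's finite form of Gauss's identity. -/
theorem gaussProd_eq_sum {q : ℝ} (h0 : 0 < q) (h1 : q < 1) (n : ℕ) :
    1 + 2 * ∑ s ∈ Finset.range n, (-1 : ℝ) ^ (s + 1) * q ^ ((s + 1) ^ 2) =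
      gaussProd q n + 2 * ∑ s ∈ Finset.range n, (-1 : ℝ) ^ (s + 1) *
        (gaussProd q n / gaussProd q (s + 1) * q ^ ((s + 1) * (n + 1)) / (1 + q ^ (s + 1))) := by
  induction n with
  | zero => simp [gaussProd]
  | succ n ih =>
    rw [Finset.sum_range_succ, mul_add, ← add_assoc, ih]
    -- Passing from `n` to `n + 1` changes the sum over `s` by an alternating telescoping sum.
    have tel : ∀ m : ℕ, ∑ s ∈ Finset.range m, (-1 : ℝ) ^ (s + 1) *
        (gaussProd q (n + 1) / gaussProd q (s + 1) * q ^ ((s + 1) * (n + 1 + 1)) /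
          (1 + q ^ (s + 1))) =
        ∑ s ∈ Finset.range m, (-1 : ℝ) ^ (s + 1) *
        (gaussProd q n / gaussProd q (s + 1) * q ^ ((s + 1) * (n + 1)) / (1 + q ^ (s + 1))) +
        gaussProd q n * q ^ (n + 1) / (1 + q ^ (n + 1)) -
        (-1) ^ m * (gaussProd q n / gaussProd q m * q ^ ((m + 1) * (n + 1)) /
          (1 + q ^ (n + 1))) := by
      intro m
      induction m with
      | zero => simp [gaussProd]
      | succ m ihm =>
        rw [Finset.sum_range_succ, ihm, Finset.sum_range_succ, gaussProd_succ q n,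
          gaussProd_succ q m]
        have hm := (gaussProd_pos h0 h1 m).ne'
        have hq : (1 - q ^ (m + 1)) ≠ 0 := by
          have : q ^ (m + 1) < 1 := pow_lt_one₀ h0.le h1 (Nat.succ_ne_zero m)
          linarith
        have hq' : (1 + q ^ (m + 1)) ≠ 0 := by positivity
        have hq'' : (1 + q ^ (n + 1)) ≠ 0 := by positivity
        have e1 : q ^ ((m + 1) * (n + 1 + 1)) = q ^ (m + 1) * q ^ ((m + 1) * (n + 1)) := by
          rw [← pow_add]; ring_nf
        have e2 : q ^ ((m + 1 + 1) * (n + 1)) = q ^ (n + 1) * q ^ ((m + 1) * (n + 1)) := by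
          rw [← pow_add]; ring_nf
        rw [e1, e2, pow_succ (-1 : ℝ) m]
        generalize ∑ s ∈ Finset.range m, (-1 : ℝ) ^ (s + 1) * (gaussProd q n /
          gaussProd q (s + 1) * q ^ ((s + 1) * (n + 1)) / (1 + q ^ (s + 1))) = S
        field_simp
        ring
    rw [Finset.sum_range_succ, tel n, gaussProd_succ q n]
    have hn := (gaussProd_pos h0 h1 n).ne'
    have hq : (1 - q ^ (n + 1)) ≠ 0 := by
      have : q ^ (n + 1) < 1 := pow_lt_one₀ h0.le h1 (Nat.succ_ne_zero n)
      linarith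
    have hq' : (1 + q ^ (n + 1)) ≠ 0 := by positivity
    have e1 : q ^ ((n + 1) * (n + 1 + 1)) = q ^ (n + 1) * q ^ ((n + 1) * (n + 1)) := by
      rw [← pow_add]; ring_nf
    rw [e1, pow_succ (-1 : ℝ) n, sq (n + 1)]
    field_simp
    ring

/-- Gauss's identity. In Shanks's formula all terms but the partial product tend to zero, since
each of the `n` summands is at most `q ^ n`. -/
theorem tendsto_gaussProd {s : ℝ} (hs : 0 < s) :
    Filter.Tendsto (gaussProd (Real.exp (-Real.pi * s))) Filter.atTop (nhds (thetaFour s)) := by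
  set q := Real.exp (-Real.pi * s) with hq
  have h0 : 0 < q := Real.exp_pos _
  have h1 : q < 1 := Real.exp_lt_one_iff.mpr (by nlinarith [Real.pi_pos, mul_pos Real.pi_pos hs])
  have hsum : Summable fun n : ℕ => (-1 : ℝ) ^ (n + 1) *
      Real.exp (-Real.pi * s * (n + 1) ^ 2) := by
    refine Summable.of_norm_bounded (summable_exp_nat_add_sq hs 1) fun n => ?_
    simp
  have hT : Filter.Tendsto (fun n => 1 + 2 * ∑ k ∈ Finset.range n, (-1 : ℝ) ^ (k + 1) *
      q ^ ((k + 1) ^ 2)) Filter.atTop (nhds (thetaFour s)) := by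
    have e : ∀ k : ℕ, q ^ ((k + 1) ^ 2) = Real.exp (-Real.pi * s * (k + 1) ^ 2) := by
      intro k
      rw [hq, ← Real.exp_nat_mul]
      congr 1
      push_cast
      ring
    simp_rw [e]
    exact (hsum.hasSum.tendsto_sum_nat.const_mul 2).const_add 1
  have hlim : Filter.Tendsto (fun n : ℕ => 2 * ((n : ℝ) * q ^ n)) Filter.atTop (nhds 0) := by
    simpa using (tendsto_self_mul_const_pow_of_lt_one h0.le h1).const_mul 2
  have hE : Filter.Tendsto (fun n => (1 + 2 * ∑ k ∈ Finset.range n, (-1 : ℝ) ^ (k + 1) *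
      q ^ ((k + 1) ^ 2)) - gaussProd q n) Filter.atTop (nhds 0) := by
    refine squeeze_zero_norm (fun n => ?_) hlim
    rw [gaussProd_eq_sum h0 h1, add_sub_cancel_left, norm_mul, Real.norm_two]
    gcongr
    refine (norm_sum_le _ _).trans ?_
    have : ∀ k ∈ Finset.range n, ‖(-1 : ℝ) ^ (k + 1) *
        (gaussProd q n / gaussProd q (k + 1) * q ^ ((k + 1) * (n + 1)) / (1 + q ^ (k + 1)))‖ ≤
        q ^ n := by
      intro k hk
      have hk' : k + 1 ≤ n := by simpa using hk
      rw [norm_mul, norm_pow, norm_neg, norm_one, one_pow, one_mul]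
      have p1 := gaussProd_pos h0 h1 n
      have p2 := gaussProd_pos h0 h1 (k + 1)
      rw [Real.norm_of_nonneg (by positivity)]
      have b1 : gaussProd q n / gaussProd q (k + 1) ≤ 1 :=
        (div_le_one p2).mpr (gaussProd_antitone h0 h1 hk')
      have b2 : q ^ ((k + 1) * (n + 1)) ≤ q ^ n :=
        pow_le_pow_of_le_one h0.le h1.le (by nlinarith)
      refine (div_le_self (by positivity) (by linarith [pow_pos h0 (k + 1)])).trans ?_
      calc _ ≤ 1 * q ^ n := by gcongr
        _ = q ^ n := one_mul _
    refine (Finset.sum_le_sum this).trans ?_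
    simp
  simpa using hT.sub hE

theorem halfTheta_pos {b : ℝ} (hb : 0 < b) : 0 < halfTheta b :=
  (summable_exp_nat_add_sq hb (1 / 2)).tsum_pos (fun _ => (Real.exp_pos _).le) 0 (Real.exp_pos _)

/-- The transformation of `θ₂` into `θ₄` under inversion. -/
theorem two_sqrt_mul_halfTheta {b : ℝ} (hb : 0 < b) :
    2 * Real.sqrt b * halfTheta b = thetaFour (1 / b) := by
  have h := hasSum_alternating_gaussian hb 0
  have e1 : ∑' l : ℕ, Real.exp (-Real.pi * b * (l + 1 / 2) ^ 2) *
        Real.cos (Real.pi * (2 * l + 1) * 0) = halfTheta b := by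
    simp [halfTheta]
  rw [e1] at h
  set f : ℤ → ℝ := fun k => (-1 : ℝ) ^ k * Real.exp (-Real.pi / b * (k + 0) ^ 2) with hf
  have s1 : Summable fun n : ℕ => f ((n : ℤ) + 1) :=
    h.summable.comp_injective (i := fun n : ℕ => (n : ℤ) + 1) (fun a b hab => by simpa using hab)
  have e2 : ∀ n : ℕ, f (-((n : ℤ) + 1)) = f ((n : ℤ) + 1) := by
    intro n
    simp only [hf]
    rw [zpow_neg, ← inv_zpow, show ((-1 : ℝ))⁻¹ = -1 by norm_num]
    push_cast
    rw [add_zero, neg_sq, add_zero]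
  have s2 : Summable fun n : ℕ => f (-((n : ℤ) + 1)) := by simp_rw [e2]; exact s1
  have h2 := HasSum.of_add_one_of_neg_add_one s1.hasSum s2.hasSum
  rw [h.unique h2]
  simp_rw [e2]
  have e3 : ∀ n : ℕ, f ((n : ℤ) + 1) = (-1 : ℝ) ^ (n + 1) *
      Real.exp (-Real.pi * (1 / b) * (n + 1) ^ 2) := by
    intro n
    simp only [hf]
    rw [show ((n : ℤ) + 1) = ((n + 1 : ℕ) : ℤ) by push_cast; rfl, zpow_natCast]
    push_cast
    rw [add_zero]
    ring_nf
  have e0 : f 0 = 1 := by simp [hf]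
  simp_rw [e3, e0, thetaFour]
  ring

theorem thetaFour_pos {s : ℝ} (hs : 0 < s) : 0 < thetaFour s := by
  have h := two_sqrt_mul_halfTheta (b := 1 / s) (by positivity)
  rw [one_div_one_div] at h
  rw [← h]
  have := halfTheta_pos (b := 1 / s) (by positivity)
  positivity

/-! ### Monotonicity on the line `x = 1 / 2` -/

/-- On the line `x = 1 / 2` the cosine series splits into a product of theta constants, since the
cosines of odd multiples of `π / 2` vanish. -/
theorem halfTheta_add_mixedTheta_half {a b : ℝ} (ha : 0 < a) (hb : 0 < b) :
    halfTheta b + 2 * mixedTheta a b (1 / 2) = halfTheta b * thetaFour (4 * a) := by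
  have hm := summable_mixedTerm ha hb (1 / 2)
  have e1 : ∀ l : ℕ, ∑' n : ℕ, mixedTerm a b (1 / 2) (n, l) =
      Real.exp (-Real.pi * b * (l + 1 / 2) ^ 2) *
        ∑' n : ℕ, (-1 : ℝ) ^ (n + 1) * Real.exp (-Real.pi * (4 * a) * (n + 1) ^ 2) := by
    intro l
    have hl : Summable fun n : ℕ => mixedTerm a b (1 / 2) (n, l) :=
      (summable_swap hm).prod_factor l
    have i1 : Function.Injective fun k : ℕ => 2 * k := fun a b h => by simpa using h
    have i2 : Function.Injective fun k : ℕ => 2 * k + 1 := fun a b h => by simpa using h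
    have s1 : Summable fun k : ℕ => mixedTerm a b (1 / 2) (2 * k, l) := hl.comp_injective i1
    have s2 : Summable fun k : ℕ => mixedTerm a b (1 / 2) (2 * k + 1, l) := hl.comp_injective i2
    rw [← tsum_even_add_odd (f := fun n : ℕ => mixedTerm a b (1 / 2) (n, l)) s1 s2]
    have z : ∀ k : ℕ, mixedTerm a b (1 / 2) (2 * k, l) = 0 := by
      intro k
      rw [mixedTerm]
      apply mul_eq_zero_of_right
      rw [Real.cos_eq_zero_iff]
      refine ⟨2 * k * l + k + l, ?_⟩
      push_cast
      ring
    simp_rw [z, tsum_zero, zero_add]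
    rw [← tsum_mul_left]
    congr 1
    ext k
    rw [mixedTerm]
    have hc : Real.cos (Real.pi * (((2 * k + 1 : ℕ) : ℝ) + 1) * (2 * l + 1) * (1 / 2)) =
        (-1) ^ (k + 1) := by
      have h2 := Real.cos_nat_mul_pi ((k + 1) * (2 * l + 1))
      rw [pow_mul', Odd.neg_one_pow ⟨l, rfl⟩] at h2
      rw [← h2]
      congr 1
      push_cast
      ring
    simp only [hc]
    rw [show (2 * k + 1 + 1) = 2 * (k + 1) by ring, pow_mul]
    push_cast
    ring_nf
  rw [mixedTheta, tsum_prod_swap hm]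
  simp_rw [e1]
  rw [tsum_mul_right, ← halfTheta, thetaFour]
  ring

/-- `sinh A / A` increases strictly, by the strict convexity of `sinh` on `[0, ∞)`. -/
theorem mul_sinh_lt {A B : ℝ} (hA : 0 < A) (hAB : A < B) :
    B * Real.sinh A < A * Real.sinh B := by
  have hconv : StrictConvexOn ℝ (Set.Ici 0) Real.sinh := by
    apply strictConvexOn_of_deriv2_pos (convex_Ici 0) Real.continuous_sinh.continuousOn
    intro x hx
    rw [interior_Ici] at hx
    simpa using Real.sinh_pos_iff.mpr hx
  have hB : 0 < B := hA.trans hAB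
  have h := hconv.2 (Set.mem_Ici.mpr hB.le) (Set.mem_Ici.mpr le_rfl) hB.ne'
    (div_pos hA hB) (sub_pos.mpr ((div_lt_one hB).mpr hAB)) (by ring)
  simp only [smul_eq_mul, mul_zero, add_zero, Real.sinh_zero] at h
  rw [div_mul_cancel₀ _ hB.ne', div_mul_eq_mul_div, lt_div_iff₀ hB] at h
  linarith

/-- Since `(1 - exp (-w)) / (1 + exp (-w)) = tanh (w / 2)`, this is the function
`tanh (c / (2 y)) * tanh (2 c y)`. For `y > 1 / 2` we have `c / y < 4 c y`, and the
derivative is negative because `w / sinh w` is smaller at the larger of these two arguments. -/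
theorem strictAntiOn_gaussFactor_mul {c : ℝ} (hc : 0 < c) :
    StrictAntiOn (fun y : ℝ => (1 - Real.exp (-(c / y))) / (1 + Real.exp (-(c / y))) *
      ((1 - Real.exp (-(4 * c * y))) / (1 + Real.exp (-(4 * c * y))))) (Set.Ici (1 / 2)) := by
  have key : ∀ w : ℝ, HasDerivAt (fun w => (1 - Real.exp (-w)) / (1 + Real.exp (-w)))
      (2 * Real.exp (-w) / (1 + Real.exp (-w)) ^ 2) w := by
    intro w
    have he : HasDerivAt (fun w => Real.exp (-w)) (-Real.exp (-w)) w := by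
      simpa using (hasDerivAt_neg w).exp
    have hne : 1 + Real.exp (-w) ≠ 0 := by positivity
    refine ((he.const_sub 1).div (he.const_add 1) hne).congr_deriv ?_
    field_simp
    ring
  have hd : ∀ y : ℝ, 0 < y → HasDerivAt (fun y : ℝ =>
      (1 - Real.exp (-(c / y))) / (1 + Real.exp (-(c / y))) *
      ((1 - Real.exp (-(4 * c * y))) / (1 + Real.exp (-(4 * c * y)))))
      (2 * Real.exp (-(c / y)) / (1 + Real.exp (-(c / y))) ^ 2 * (-c / y ^ 2) *
        ((1 - Real.exp (-(4 * c * y))) / (1 + Real.exp (-(4 * c * y)))) +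
        (1 - Real.exp (-(c / y))) / (1 + Real.exp (-(c / y))) *
        (2 * Real.exp (-(4 * c * y)) / (1 + Real.exp (-(4 * c * y))) ^ 2 * (4 * c))) y := by
    intro y hy
    have h1 : HasDerivAt (fun y : ℝ => c / y) (-c / y ^ 2) y := by
      simpa [div_eq_mul_inv] using (hasDerivAt_inv hy.ne').const_mul c
    have h2 : HasDerivAt (fun y : ℝ => 4 * c * y) (4 * c) y := by
      simpa using (hasDerivAt_id y).const_mul (4 * c)
    exact ((key _).comp y h1).mul ((key _).comp y h2)
  apply strictAntiOn_of_deriv_neg (convex_Ici _)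
  · intro y hy
    have hy' : (1 / 2 : ℝ) ≤ y := hy
    exact (hd y (by linarith)).continuousAt.continuousWithinAt
  · intro y hy
    rw [interior_Ici] at hy
    have hy' : (1 / 2 : ℝ) < y := hy
    have hy0 : 0 < y := by linarith
    rw [(hd y hy0).deriv]
    have hA : 0 < c / y := by positivity
    have hAB : c / y < 4 * c * y := by
      rw [div_lt_iff₀ hy0]
      nlinarith [mul_pos hc (by nlinarith : 0 < 4 * y ^ 2 - 1)]
    have hk := mul_sinh_lt hA hAB
    rw [Real.sinh_eq, Real.sinh_eq, Real.exp_neg, Real.exp_neg] at hk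
    rw [Real.exp_neg, Real.exp_neg]
    have pu : 0 < Real.exp (c / y) := Real.exp_pos _
    have pv : 0 < Real.exp (4 * c * y) := Real.exp_pos _
    set u := Real.exp (c / y)
    set v := Real.exp (4 * c * y)
    have e : 2 * u⁻¹ / (1 + u⁻¹) ^ 2 * (-c / y ^ 2) * ((1 - v⁻¹) / (1 + v⁻¹)) +
        (1 - u⁻¹) / (1 + u⁻¹) * (2 * v⁻¹ / (1 + v⁻¹) ^ 2 * (4 * c)) =
        4 * u * v / (y * (1 + u) ^ 2 * (1 + v) ^ 2) *
        (4 * c * y * ((u - u⁻¹) / 2) - c / y * ((v - v⁻¹) / 2)) := by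
      field_simp
      ring
    rw [e]
    exact mul_neg_of_pos_of_neg (by positivity) (by linarith)

/-- The product of theta constants that describes the line `x = 1 / 2` decreases strictly in
`y ≥ 1 / 2`: every factor of Gauss's product does. -/
theorem thetaFour_mul_lt {β y₀ y : ℝ} (hβ : 0 < β) (hy₀ : 1 / 2 ≤ y₀) (hy : y₀ < y) :
    thetaFour (β / y) * thetaFour (4 * β * y) < thetaFour (β / y₀) * thetaFour (4 * β * y₀) := by
  have hy0 : 0 < y₀ := by linarith
  have hyp : 0 < y := by linarith
  set g : ℕ → ℝ → ℝ := fun k y =>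
    (1 - Real.exp (-(Real.pi * (k + 1) * β / y))) /
      (1 + Real.exp (-(Real.pi * (k + 1) * β / y))) *
      ((1 - Real.exp (-(4 * (Real.pi * (k + 1) * β) * y))) /
        (1 + Real.exp (-(4 * (Real.pi * (k + 1) * β) * y)))) with hg
  have hprod : ∀ z : ℝ, ∀ n, gaussProd (Real.exp (-Real.pi * (β / z))) n *
      gaussProd (Real.exp (-Real.pi * (4 * β * z))) n = ∏ k ∈ Finset.range n, g k z := by
    intro z n
    rw [gaussProd, gaussProd, ← Finset.prod_mul_distrib]
    refine Finset.prod_congr rfl fun k _ => ?_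
    rw [← Real.exp_nat_mul, ← Real.exp_nat_mul]
    push_cast
    simp only [hg]
    ring_nf
  have hlim : ∀ z : ℝ, 0 < z → Filter.Tendsto (fun n => ∏ k ∈ Finset.range n, g k z) Filter.atTop
      (nhds (thetaFour (β / z) * thetaFour (4 * β * z))) := by
    intro z hz
    simp_rw [← hprod]
    exact (tendsto_gaussProd (by positivity)).mul (tendsto_gaussProd (by positivity))
  have hpos : ∀ k z, 0 < z → 0 < g k z := by
    intro k z hz
    have h1 : Real.exp (-(Real.pi * (k + 1) * β / z)) < 1 :=
      Real.exp_lt_one_iff.mpr (by have := Real.pi_pos; rw [neg_lt_zero]; positivity)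
    have h2 : Real.exp (-(4 * (Real.pi * (k + 1) * β) * z)) < 1 :=
      Real.exp_lt_one_iff.mpr (by have := Real.pi_pos; rw [neg_lt_zero]; positivity)
    exact mul_pos (div_pos (by linarith) (by positivity)) (div_pos (by linarith) (by positivity))
  have hlt : ∀ k, g k y < g k y₀ := fun k =>
    strictAntiOn_gaussFactor_mul (c := Real.pi * (k + 1) * β)
      (by have := Real.pi_pos; positivity) (Set.mem_Ici.mpr hy₀)
      (Set.mem_Ici.mpr (hy₀.trans hy.le)) hy
  have hr : g 0 y / g 0 y₀ < 1 := (div_lt_one (hpos 0 y₀ hy0)).mpr (hlt 0)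
  have hle : ∀ n : ℕ, ∏ k ∈ Finset.range (n + 1), g k y ≤
      g 0 y / g 0 y₀ * ∏ k ∈ Finset.range (n + 1), g k y₀ := by
    intro n
    have e : g 0 y / g 0 y₀ * ((∏ k ∈ Finset.range n, g (k + 1) y₀) * g 0 y₀) =
        (∏ k ∈ Finset.range n, g (k + 1) y₀) * g 0 y := by
      have := (hpos 0 y₀ hy0).ne'
      clear_value g
      field_simp
    rw [Finset.prod_range_succ', Finset.prod_range_succ', e]
    exact mul_le_mul_of_nonneg_right (Finset.prod_le_prod (fun k _ => (hpos _ y hyp).le)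
      fun k _ => (hlt _).le) (hpos 0 y hyp).le
  have h := le_of_tendsto_of_tendsto' ((hlim y hyp).comp (Filter.tendsto_add_atTop_nat 1))
    (((hlim y₀ hy0).comp (Filter.tendsto_add_atTop_nat 1)).const_mul (g 0 y / g 0 y₀)) hle
  refine h.trans_lt ?_
  have hp : 0 < thetaFour (β / y₀) * thetaFour (4 * β * y₀) :=
    mul_pos (thetaFour_pos (by positivity)) (thetaFour_pos (by positivity))
  nlinarith

/-! ### Elementary estimates -/

theorem abs_sin_natCast_mul_le (k : ℕ) (θ : ℝ) : |Real.sin (k * θ)| ≤ k * |Real.sin θ| := by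
  induction k with
  | zero => simp
  | succ k ih =>
    push_cast
    rw [add_mul, one_mul, Real.sin_add]
    calc |Real.sin (k * θ) * Real.cos θ + Real.cos (k * θ) * Real.sin θ|
        ≤ |Real.sin (k * θ) * Real.cos θ| + |Real.cos (k * θ) * Real.sin θ| := abs_add_le _ _
      _ = |Real.sin (k * θ)| * |Real.cos θ| + |Real.cos (k * θ)| * |Real.sin θ| := by
          rw [abs_mul, abs_mul]
      _ ≤ |Real.sin (k * θ)| * 1 + 1 * |Real.sin θ| := by
          gcongr
          · exact Real.abs_cos_le_one _
          · exact Real.abs_cos_le_one _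
      _ ≤ (k + 1) * |Real.sin θ| := by linarith

theorem abs_cos_odd_mul_le (l : ℕ) (θ : ℝ) :
    |Real.cos ((2 * l + 1) * θ)| ≤ (2 * l + 1) * |Real.cos θ| := by
  have h := abs_sin_natCast_mul_le (2 * l + 1) (Real.pi / 2 - θ)
  rw [Real.sin_pi_div_two_sub] at h
  have e : Real.cos ((2 * l + 1) * θ) =
      (-1) ^ l * Real.sin (((2 * l + 1 : ℕ) : ℝ) * (Real.pi / 2 - θ)) := by
    rw [← Real.sin_sub_nat_mul_pi, ← Real.sin_pi_div_two_sub]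
    congr 1
    push_cast
    ring
  rw [e, abs_mul, abs_pow, abs_neg, abs_one, one_pow, one_mul]
  push_cast at h
  exact_mod_cast h

/-- The difference of the cosines is `2 sin` of the half sum times `sin` of the half difference,
and the latter is `k π (1 - 2 x) / 4`. -/
theorem abs_cos_natCast_mul_sub_le (k : ℕ) (x : ℝ) :
    |Real.cos (Real.pi * k * (1 / 2)) - Real.cos (Real.pi * k * x)| ≤
      2 * k * |Real.sin (Real.pi * (1 - 2 * x) / 4)| := by
  rw [Real.cos_sub_cos, abs_mul, abs_mul, abs_neg, abs_two]
  have h := abs_sin_natCast_mul_le k (Real.pi * (1 - 2 * x) / 4)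
  rw [show (Real.pi * k * (1 / 2) - Real.pi * k * x) / 2 = k * (Real.pi * (1 - 2 * x) / 4) by ring]
  calc _ ≤ 2 * 1 * (k * |Real.sin (Real.pi * (1 - 2 * x) / 4)|) := by
        gcongr
        exact Real.abs_sin_le_one _
    _ = _ := by ring

theorem hasSum_affine_mul_geometric {ρ : ℝ} (h0 : 0 ≤ ρ) (h1 : ρ < 1) (p q : ℝ) :
    HasSum (fun n : ℕ => (p * n + q) * ρ ^ n) (p * ρ / (1 - ρ) ^ 2 + q / (1 - ρ)) := by
  have a := (hasSum_coe_mul_geometric_of_norm_lt_one (r := ρ)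
    (by rwa [Real.norm_of_nonneg h0])).mul_left p
  have b := (hasSum_geometric_of_lt_one h0 h1).mul_left q
  have e : (fun n : ℕ => (p * n + q) * ρ ^ n) = fun n : ℕ => p * (n * ρ ^ n) + q * ρ ^ n := by
    ext n
    ring
  rw [e, mul_div_assoc, div_eq_mul_inv q]
  exact a.add b

theorem summable_of_le_affine {f : ℕ → ℝ} {ρ p q : ℝ} (h0 : 0 ≤ ρ) (h1 : ρ < 1)
    (hf : ∀ n, 0 ≤ f n) (hle : ∀ n, f n ≤ (p * n + q) * ρ ^ n) : Summable f :=
  Summable.of_nonneg_of_le hf hle (hasSum_affine_mul_geometric h0 h1 p q).summable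

theorem tsum_le_of_le_affine {f : ℕ → ℝ} {ρ p q : ℝ} (h0 : 0 ≤ ρ) (h1 : ρ < 1)
    (hf : ∀ n, 0 ≤ f n) (hle : ∀ n, f n ≤ (p * n + q) * ρ ^ n) :
    ∑' n, f n ≤ p * ρ / (1 - ρ) ^ 2 + q / (1 - ρ) := by
  rw [← (hasSum_affine_mul_geometric h0 h1 p q).tsum_eq]
  exact (summable_of_le_affine h0 h1 hf hle).tsum_le_tsum hle
    (hasSum_affine_mul_geometric h0 h1 p q).summable

/-- The geometric majorant for `ρ ≤ 1 / 10`. -/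
theorem affine_geometric_le {ρ p q : ℝ} (h1 : ρ ≤ 1 / 10) (hp : 0 ≤ p) (hq : 0 ≤ q) :
    p * ρ / (1 - ρ) ^ 2 + q / (1 - ρ) ≤ 10 / 81 * p + 10 / 9 * q := by
  have h2 : 0 < 1 - ρ := by linarith
  have a : p * ρ / (1 - ρ) ^ 2 ≤ 10 / 81 * p := by
    rw [div_le_iff₀ (by positivity)]
    have : ρ ≤ 10 / 81 * (1 - ρ) ^ 2 := by nlinarith
    nlinarith
  have b : q / (1 - ρ) ≤ 10 / 9 * q := by
    rw [div_le_iff₀ h2]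
    nlinarith
  linarith

theorem one_sub_exp_neg_ge {u : ℝ} (hu : 0 ≤ u) : u / (1 + u) ≤ 1 - Real.exp (-u) := by
  rw [Real.exp_neg, div_le_iff₀ (by linarith)]
  have h := Real.add_one_le_exp u
  have h2 : (Real.exp u)⁻¹ * (1 + u) ≤ 1 := by
    rw [inv_mul_le_iff₀ (Real.exp_pos u)]
    linarith
  nlinarith

theorem one_sub_exp_neg_mul_le {k u : ℝ} (hk : 1 ≤ k) :
    1 - Real.exp (-(k * u)) ≤ k * (1 - Real.exp (-u)) := by
  -- Bernoulli's inequality for `exp (-u)`.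
  have h := one_add_mul_self_le_rpow_one_add (s := Real.exp (-u) - 1)
    (by linarith [Real.exp_pos (-u)]) hk
  rw [add_sub_cancel, ← Real.exp_mul] at h
  rw [show -(k * u) = -u * k by ring]
  linarith

theorem exp_neg_le_tenth {u : ℝ} (hu : 2.355 ≤ u) : Real.exp (-u) ≤ 1 / 10 := by
  rw [Real.exp_neg, one_div]
  apply inv_anti₀ (by norm_num)
  have h1 : (2.718 : ℝ) ≤ Real.exp 1 := by linarith [Real.exp_one_gt_d9]
  have h2 : (1.41 : ℝ) ≤ Real.exp 0.355 := by
    refine le_trans ?_ (Real.quadratic_le_exp_of_nonneg (by norm_num))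
    norm_num
  calc (10 : ℝ) ≤ 2.718 ^ 2 * 1.41 := by norm_num
    _ ≤ Real.exp 1 ^ 2 * Real.exp 0.355 := by gcongr
    _ = Real.exp 2.355 := by rw [← Real.exp_nat_mul, ← Real.exp_add]; norm_num
    _ ≤ Real.exp u := Real.exp_le_exp.mpr hu

theorem exp_neg_le_twentieth {u : ℝ} (hu : 3 ≤ u) : Real.exp (-u) ≤ 1 / 20 := by
  rw [Real.exp_neg, one_div]
  apply inv_anti₀ (by norm_num)
  have h1 : (2.718 : ℝ) ≤ Real.exp 1 := by linarith [Real.exp_one_gt_d9]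
  calc (20 : ℝ) ≤ 2.718 ^ 3 := by norm_num
    _ ≤ Real.exp 1 ^ 3 := by gcongr
    _ = Real.exp 3 := by rw [← Real.exp_nat_mul]; norm_num
    _ ≤ Real.exp u := Real.exp_le_exp.mpr hu

theorem exp_neg_le_hundredth {u : ℝ} (hu : 5 ≤ u) : Real.exp (-u) ≤ 1 / 100 := by
  rw [Real.exp_neg, one_div]
  apply inv_anti₀ (by norm_num)
  have h1 : (2.718 : ℝ) ≤ Real.exp 1 := by linarith [Real.exp_one_gt_d9]
  calc (100 : ℝ) ≤ 2.718 ^ 5 := by norm_num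
    _ ≤ Real.exp 1 ^ 5 := by gcongr
    _ = Real.exp 5 := by rw [← Real.exp_nat_mul]; norm_num
    _ ≤ Real.exp u := Real.exp_le_exp.mpr hu

/-! ### Bounds for the weights of the cosine series -/

theorem exp_le_geometric {c u : ℝ} {n : ℕ} (v : ℝ) (h : v + u * n ≤ c) :
    Real.exp (-Real.pi * c) ≤ Real.exp (-Real.pi * v) * Real.exp (-(Real.pi * u)) ^ n := by
  rw [← Real.exp_nat_mul, ← Real.exp_add, Real.exp_le_exp]
  nlinarith [mul_le_mul_of_nonneg_left h Real.pi_pos.le]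


/-- A double series bounded termwise by products of weights is at least its first column minus the
bound for all other columns. -/
theorem tsum_ge_first_column {F : ℕ × ℕ → ℝ} {u v : ℕ → ℝ} {c : ℝ} (hF : Summable F)
    (hu : Summable u) (hv : Summable v) (h : ∀ p, |F p| ≤ c * (u p.1 * v p.2)) :
    ∑' l, F (0, l) - c * (∑' n, u (n + 1)) * ∑' l, v l ≤ ∑' p, F p := by
  rw [hF.tsum_prod, hF.prod.tsum_eq_zero_add]
  have h1 : ∀ n, -(c * u (n + 1) * ∑' l, v l) ≤ ∑' l, F (n + 1, l) := by
    intro n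
    rw [← tsum_mul_left, ← tsum_neg]
    refine Summable.tsum_le_tsum (fun l => ?_) (hv.mul_left _).neg (hF.prod_factor (n + 1))
    have := (abs_le.mp (h (n + 1, l))).1
    simp only at this
    linarith
  have hu' := (summable_nat_add_iff 1).mpr hu
  have h2 := Summable.tsum_le_tsum h1 ((hu'.mul_left c).mul_right _).neg
    ((summable_nat_add_iff 1).mpr hF.prod)
  rw [tsum_neg, tsum_mul_right, tsum_mul_left] at h2
  linarith

/-- The weight of the integral frequency `n + 1`. -/
noncomputable def intWeight (a : ℝ) (n : ℕ) : ℝ := (n + 1) * Real.exp (-Real.pi * a * (n + 1) ^ 2)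

/-- The weight of the half-integral frequency `l + 1 / 2`. -/
noncomputable def oddWeight (b : ℝ) (l : ℕ) : ℝ :=
  (2 * l + 1) * Real.exp (-Real.pi * b * (l + 1 / 2) ^ 2)

theorem intWeight_nonneg (a : ℝ) (n : ℕ) : 0 ≤ intWeight a n := by
  unfold intWeight; positivity

theorem oddWeight_nonneg (b : ℝ) (l : ℕ) : 0 ≤ oddWeight b l := by
  unfold oddWeight; positivity

theorem intWeight_le {a : ℝ} (ha : 0 < a) (n : ℕ) :
    intWeight a n ≤ (1 * n + 1) * Real.exp (-(Real.pi * (2 * a))) ^ n := by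
  rw [intWeight, one_mul, mul_assoc]
  have h := exp_le_geometric (c := a * ((n : ℝ) + 1) ^ 2) (u := 2 * a) (n := n) 0
    (by nlinarith [mul_nonneg ha.le (sq_nonneg (n : ℝ))])
  rw [mul_zero, Real.exp_zero, one_mul] at h
  gcongr

theorem oddWeight_le {b : ℝ} (hb : 0 < b) (l : ℕ) :
    oddWeight b l ≤ (2 * l + 1) * Real.exp (-(Real.pi * (2 * b))) ^ l := by
  rw [oddWeight, mul_assoc (-Real.pi)]
  have h := exp_le_geometric (c := b * ((l : ℝ) + 1 / 2) ^ 2) (u := 2 * b) (n := l) 0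
    (by nlinarith [mul_nonneg hb.le (sq_nonneg ((l : ℝ) - 1 / 2))])
  rw [mul_zero, Real.exp_zero, one_mul] at h
  gcongr

theorem exp_neg_pi_mul_lt_one {u : ℝ} (hu : 0 < u) : Real.exp (-(Real.pi * u)) < 1 :=
  Real.exp_lt_one_iff.mpr (neg_lt_zero.mpr (mul_pos Real.pi_pos hu))

theorem summable_intWeight {a : ℝ} (ha : 0 < a) : Summable (intWeight a) :=
  summable_of_le_affine (Real.exp_pos _).le (exp_neg_pi_mul_lt_one (by positivity))
    (intWeight_nonneg a) (intWeight_le ha)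

theorem summable_oddWeight {b : ℝ} (hb : 0 < b) : Summable (oddWeight b) :=
  summable_of_le_affine (Real.exp_pos _).le (exp_neg_pi_mul_lt_one (by positivity))
    (oddWeight_nonneg b) (oddWeight_le hb)

theorem tsum_intWeight_le_inv_sq {a : ℝ} (ha : 0 < a) (ha' : a ≤ 1 / 4) :
    ∑' n, intWeight a n ≤ (a ^ 2)⁻¹ := by
  have h1 := exp_neg_pi_mul_lt_one (u := 2 * a) (by positivity)
  refine (tsum_le_of_le_affine (Real.exp_pos _).le h1 (intWeight_nonneg a)
    (intWeight_le ha)).trans ?_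
  have h2 := one_sub_exp_neg_ge (u := Real.pi * (2 * a)) (by positivity)
  set ρ := Real.exp (-(Real.pi * (2 * a)))
  have h3 : a ≤ 1 - ρ := by
    refine le_trans ?_ h2
    rw [le_div_iff₀ (by positivity)]
    nlinarith [Real.pi_gt_three, mul_pos ha Real.pi_pos]
  have h4 : 0 < 1 - ρ := by linarith
  rw [show 1 * ρ / (1 - ρ) ^ 2 + 1 / (1 - ρ) = ((1 - ρ) ^ 2)⁻¹ by field_simp; ring]
  gcongr

theorem tsum_oddWeight_le_inv_sq {b : ℝ} (hb : 0 < b) (hb' : b ≤ 1 / 2) :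
    ∑' l, oddWeight b l ≤ (b ^ 2)⁻¹ := by
  have h1 := exp_neg_pi_mul_lt_one (u := 2 * b) (by positivity)
  refine (tsum_le_of_le_affine (Real.exp_pos _).le h1 (oddWeight_nonneg b)
    (oddWeight_le hb)).trans ?_
  have h2 := one_sub_exp_neg_ge (u := Real.pi * (2 * b)) (by positivity)
  have h0 : 0 < Real.exp (-(Real.pi * (2 * b))) := Real.exp_pos _
  set ρ := Real.exp (-(Real.pi * (2 * b)))
  have h3 : 3 / 2 * b ≤ 1 - ρ := by
    refine le_trans ?_ h2
    rw [le_div_iff₀ (by positivity)]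
    nlinarith [Real.pi_gt_three, mul_pos hb Real.pi_pos]
  have h4 : 0 < 1 - ρ := by linarith
  rw [show 2 * ρ / (1 - ρ) ^ 2 + 1 / (1 - ρ) = (1 + ρ) / (1 - ρ) ^ 2 by field_simp; ring,
    div_le_iff₀ (by positivity), inv_mul_eq_div, le_div_iff₀ (by positivity)]
  nlinarith [mul_self_le_mul_self (by positivity) h3]

theorem tsum_intWeight_succ_le {a : ℝ} (ha : Real.exp (-(Real.pi * (3 * a))) ≤ 1 / 10)
    (ha0 : 0 < a) : ∑' n, intWeight a (n + 1) ≤ 3 * Real.exp (-Real.pi * (4 * a)) := by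
  have h1 := exp_neg_pi_mul_lt_one (u := 3 * a) (by positivity)
  have hE := Real.exp_pos (-Real.pi * (4 * a))
  refine (tsum_le_of_le_affine (p := Real.exp (-Real.pi * (4 * a)))
    (q := 2 * Real.exp (-Real.pi * (4 * a))) (Real.exp_pos _).le h1
    (fun n => intWeight_nonneg a _) fun n => ?_).trans
    ((affine_geometric_le ha hE.le (by positivity)).trans (by linarith))
  have h := exp_le_geometric (c := a * ((n : ℝ) + 1 + 1) ^ 2) (u := 3 * a) (n := n) (4 * a)
    (by nlinarith [mul_nonneg ha0.le (sq_nonneg (n : ℝ)), mul_nonneg ha0.le (Nat.cast_nonneg n)])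
  rw [intWeight, mul_assoc (-Real.pi)]
  push_cast
  calc ((n : ℝ) + 1 + 1) * Real.exp (-Real.pi * (a * ((n : ℝ) + 1 + 1) ^ 2))
      ≤ ((n : ℝ) + 1 + 1) * (Real.exp (-Real.pi * (4 * a)) *
        Real.exp (-(Real.pi * (3 * a))) ^ n) := by gcongr
    _ = _ := by ring

theorem tsum_oddWeight_succ_le {b : ℝ} (hb : Real.exp (-(Real.pi * (2 * b))) ≤ 1 / 10)
    (hb0 : 0 < b) : ∑' l, oddWeight b (l + 1) ≤ 4 * Real.exp (-Real.pi * (9 / 4 * b)) := by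
  have h1 := exp_neg_pi_mul_lt_one (u := 2 * b) (by positivity)
  have hE := Real.exp_pos (-Real.pi * (9 / 4 * b))
  refine (tsum_le_of_le_affine (p := 2 * Real.exp (-Real.pi * (9 / 4 * b)))
    (q := 3 * Real.exp (-Real.pi * (9 / 4 * b))) (Real.exp_pos _).le h1
    (fun n => oddWeight_nonneg b _) fun n => ?_).trans
    ((affine_geometric_le hb (by positivity) (by positivity)).trans (by linarith))
  have h := exp_le_geometric (c := b * ((n : ℝ) + 1 + 1 / 2) ^ 2) (u := 2 * b) (n := n)
    (9 / 4 * b)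
    (by nlinarith [mul_nonneg hb0.le (sq_nonneg (n : ℝ)), mul_nonneg hb0.le (Nat.cast_nonneg n)])
  rw [oddWeight, mul_assoc (-Real.pi)]
  push_cast
  calc (2 * ((n : ℝ) + 1) + 1) * Real.exp (-Real.pi * (b * ((n : ℝ) + 1 + 1 / 2) ^ 2))
      ≤ (2 * ((n : ℝ) + 1) + 1) * (Real.exp (-Real.pi * (9 / 4 * b)) *
        Real.exp (-(Real.pi * (2 * b))) ^ n) := by gcongr
    _ = _ := by ring

theorem intWeight_zero (a : ℝ) : intWeight a 0 = Real.exp (-Real.pi * a) := by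
  simp [intWeight]

theorem oddWeight_zero (b : ℝ) : oddWeight b 0 = Real.exp (-Real.pi * (b / 4)) := by
  rw [oddWeight]
  norm_num
  ring_nf

/-! ### Lower bounds for the dominant row and column -/

theorem tsum_ge_head_sub {f B : ℕ → ℝ} (hf : Summable f) (hB : Summable B)
    (h : ∀ m, -B m ≤ f (m + 1)) : f 0 - ∑' m, B m ≤ ∑' m, f m := by
  rw [hf.tsum_eq_zero_add]
  have := Summable.tsum_le_tsum h hB.neg ((summable_nat_add_iff 1).mpr hf)
  rw [tsum_neg] at this
  linarith

theorem sin_quarter_pos {x : ℝ} (h0 : 0 ≤ x) (hx : x < 1 / 2) :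
    0 < Real.sin (Real.pi * (1 - 2 * x) / 4) := by
  apply Real.sin_pos_of_pos_of_lt_pi
  · have := mul_pos Real.pi_pos (by linarith : 0 < 1 - 2 * x)
    positivity
  · nlinarith [Real.pi_pos, mul_nonneg Real.pi_pos.le h0]

/-- With `η = π (1 - 2 x) / 4 ≤ π / 4`, the left-hand side of `cos (π x) = 2 sin η cos η` is at
least `√2 sin η`. -/
theorem mul_sin_quarter_le_cos {x : ℝ} (h0 : 0 ≤ x) (hx : x < 1 / 2) :
    1.4 * Real.sin (Real.pi * (1 - 2 * x) / 4) ≤ Real.cos (Real.pi * x) := by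
  have hs := sin_quarter_pos h0 hx
  have e : Real.cos (Real.pi * x) = 2 * Real.sin (Real.pi * (1 - 2 * x) / 4) *
      Real.cos (Real.pi * (1 - 2 * x) / 4) := by
    rw [← Real.sin_two_mul, ← Real.sin_pi_div_two_sub]
    congr 1
    ring
  have hc : Real.cos (Real.pi / 4) ≤ Real.cos (Real.pi * (1 - 2 * x) / 4) := by
    apply Real.cos_le_cos_of_nonneg_of_le_pi
    · have := mul_pos Real.pi_pos (by linarith : 0 < 1 - 2 * x)
      positivity
    · linarith [Real.pi_pos]
    · nlinarith [mul_nonneg Real.pi_pos.le h0]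
  rw [Real.cos_pi_div_four] at hc
  have h2 : (1.4 : ℝ) ≤ Real.sqrt 2 := Real.le_sqrt_of_sq_le (by norm_num)
  rw [e]
  nlinarith

/-- `∑ exp (-π b h²) cos (2 π h x)` over the positive half-integers `h`. -/
noncomputable def oddRow (b x : ℝ) : ℝ :=
  ∑' l : ℕ, Real.exp (-Real.pi * b * (l + 1 / 2) ^ 2) * Real.cos (Real.pi * (2 * l + 1) * x)

theorem summable_oddRow {b : ℝ} (hb : 0 < b) (x : ℝ) : Summable fun l : ℕ =>
    Real.exp (-Real.pi * b * (l + 1 / 2) ^ 2) * Real.cos (Real.pi * (2 * l + 1) * x) := by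
  refine Summable.of_norm_bounded (summable_exp_nat_add_sq hb (1 / 2)) fun l => ?_
  rw [norm_mul, Real.norm_eq_abs, Real.norm_eq_abs, Real.abs_exp]
  exact mul_le_of_le_one_right (Real.exp_pos _).le (Real.abs_cos_le_one _)

/-- For `b ≥ 1 / 2` the term of frequency `1 / 2` dominates the row: each further term is at most
`cos (π x)` times its odd weight. -/
theorem oddRow_ge {b x : ℝ} (hb : 1 / 2 ≤ b) (h0 : 0 ≤ x) (hx : x < 1 / 2) :
    1.12 * Real.sin (Real.pi * (1 - 2 * x) / 4) * Real.exp (-Real.pi * (b / 4)) ≤ oddRow b x := by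
  have hb0 : 0 < b := by linarith
  have hs := sin_quarter_pos h0 hx
  have hc := mul_sin_quarter_le_cos h0 hx
  have hc0 : 0 < Real.cos (Real.pi * x) := by linarith
  have hE := Real.exp_pos (-Real.pi * (b / 4))
  have hq : Real.exp (-(Real.pi * (2 * b))) ≤ 1 / 20 :=
    exp_neg_le_twentieth (by nlinarith [Real.pi_gt_three])
  have hw := summable_oddWeight hb0
  have h1 := tsum_ge_head_sub (summable_oddRow hb0 x)
    (((summable_nat_add_iff 1).mpr hw).mul_left (Real.cos (Real.pi * x))) (fun l => by
      rw [oddWeight, neg_le]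
      refine (neg_le_abs _).trans ?_
      rw [abs_mul, Real.abs_exp]
      have h := abs_cos_odd_mul_le (l + 1) (Real.pi * x)
      rw [abs_of_pos hc0] at h
      rw [show Real.pi * (2 * ((l + 1 : ℕ) : ℝ) + 1) * x =
        (2 * ((l + 1 : ℕ) : ℝ) + 1) * (Real.pi * x) by ring]
      calc _ ≤ Real.exp (-Real.pi * b * (((l + 1 : ℕ) : ℝ) + 1 / 2) ^ 2) *
            ((2 * ((l + 1 : ℕ) : ℝ) + 1) * Real.cos (Real.pi * x)) := by gcongr
        _ = _ := by ring)
  rw [tsum_mul_left] at h1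
  have h2 := tsum_oddWeight_succ_le (by linarith) hb0
  have e : Real.exp (-Real.pi * (9 / 4 * b)) =
      Real.exp (-Real.pi * (b / 4)) * Real.exp (-(Real.pi * (2 * b))) := by
    rw [← Real.exp_add]; ring_nf
  have e0 : Real.exp (-Real.pi * b * (((0 : ℕ) : ℝ) + 1 / 2) ^ 2) *
      Real.cos (Real.pi * (2 * ((0 : ℕ) : ℝ) + 1) * x) =
      Real.exp (-Real.pi * (b / 4)) * Real.cos (Real.pi * x) := by
    congr 2
    · push_cast; ring
    · push_cast; ring
  rw [e0] at h1
  rw [oddRow]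
  refine le_trans ?_ h1
  have h3 : ∑' l, oddWeight b (l + 1) ≤ 1 / 5 * Real.exp (-Real.pi * (b / 4)) := by
    rw [e] at h2
    nlinarith
  nlinarith [mul_le_mul_of_nonneg_left h3 hc0.le, mul_le_mul_of_nonneg_left hc hE.le]

theorem exp_neg_sub_exp_neg (u v : ℝ) :
    Real.exp (-u) - Real.exp (-v) = Real.exp (-u) * (1 - Real.exp (-(v - u))) := by
  rw [mul_sub, ← Real.exp_add]
  ring_nf

theorem mul_sin_quarter_le_one_sub_exp {k x : ℝ} (hk : 2 ≤ k) (h0 : 0 ≤ x) (hx : x < 1 / 2) :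
    0.7 * Real.sin (Real.pi * (1 - 2 * x) / 4) ≤
      1 - Real.exp (-(k * (Real.pi * (1 - 2 * x) / 4))) := by
  have hη : 0 < Real.pi * (1 - 2 * x) / 4 := by
    have := mul_pos Real.pi_pos (by linarith : 0 < 1 - 2 * x)
    positivity
  have hη1 : Real.pi * (1 - 2 * x) / 4 ≤ 0.8 := by nlinarith [Real.pi_lt_d2, Real.pi_pos]
  set η := Real.pi * (1 - 2 * x) / 4
  have h1 : Real.exp (-(k * η)) ≤ Real.exp (-(2 * η)) :=
    Real.exp_le_exp.mpr (by nlinarith)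
  have h2 := one_sub_exp_neg_ge (u := 2 * η) (by positivity)
  have h3 : 0.7 * η ≤ 2 * η / (1 + 2 * η) := by
    rw [le_div_iff₀ (by positivity)]
    nlinarith
  linarith [Real.sin_le hη.le]

/-- For small `b` the row is estimated on the Gaussian side of the Poisson summation formula. -/
theorem oddRow_ge_of_le {b x : ℝ} (hb0 : 0 < b) (hb : b ≤ 1 / 2) (h0 : 0 ≤ x) (hx : x < 1 / 2) :
    0.4 * Real.sin (Real.pi * (1 - 2 * x) / 4) * Real.exp (-Real.pi * (b⁻¹ / 4)) ≤ oddRow b x := by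
  have hs := sin_quarter_pos h0 hx
  have hbi : 2 ≤ b⁻¹ := by rw [le_inv_comm₀ (by norm_num) hb0]; linarith
  have hpair := (hasSum_alternating_gaussian hb0 x).nat_add_neg_add_one
  rw [← oddRow] at hpair
  set X := Real.pi / b * (1 - 2 * x) with hX
  have hX0 : 0 < X := mul_pos (div_pos Real.pi_pos hb0) (by linarith)
  set D := 1 - Real.exp (-X) with hD
  have hD0 : 0 < D := sub_pos.mpr (Real.exp_lt_one_iff.mpr (by linarith))
  set E := Real.exp (-(Real.pi / b * x ^ 2)) with hEdef
  have hE : 0 < E := Real.exp_pos _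
  -- The Gaussians centered at `m` and `-(m + 1)` have opposite signs and nearly cancel as `x`
  -- tends to `1 / 2`; every pair carries a factor comparable with `D`.
  have hterm : ∀ m : ℕ, (-1 : ℝ) ^ (m : ℤ) * Real.exp (-Real.pi / b * (((m : ℤ) : ℝ) + x) ^ 2) +
      (-1 : ℝ) ^ (-((m : ℤ) + 1)) *
        Real.exp (-Real.pi / b * (((-((m : ℤ) + 1) : ℤ) : ℝ) + x) ^ 2) =
      (-1) ^ m * (Real.exp (-(Real.pi / b * (m + x) ^ 2)) *
        (1 - Real.exp (-((2 * m + 1) * X)))) := by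
    intro m
    have h1 := exp_neg_sub_exp_neg (Real.pi / b * (m + x) ^ 2) (Real.pi / b * (m + 1 - x) ^ 2)
    rw [show Real.pi / b * (m + 1 - x) ^ 2 - Real.pi / b * (m + x) ^ 2 = (2 * m + 1) * X by
      rw [hX]; ring] at h1
    rw [← h1, zpow_neg, ← inv_zpow, show ((-1 : ℝ))⁻¹ = -1 by norm_num, zpow_add₀ (by norm_num),
      zpow_natCast, zpow_one]
    push_cast
    rw [show -Real.pi / b * ((m : ℝ) + x) ^ 2 = -(Real.pi / b * (m + x) ^ 2) by ring,
      show -Real.pi / b * (-((m : ℝ) + 1) + x) ^ 2 = -(Real.pi / b * (m + 1 - x) ^ 2) by ring]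
    ring
  simp_rw [hterm] at hpair
  have hq : Real.exp (-(Real.pi * b⁻¹)) ≤ 1 / 100 :=
    exp_neg_le_hundredth (by nlinarith [Real.pi_gt_three])
  have hq0 : 0 < Real.exp (-(Real.pi * b⁻¹)) := Real.exp_pos _
  have hq1 : Real.exp (-(Real.pi * b⁻¹)) < 1 := by linarith
  have hB := (hasSum_affine_mul_geometric hq0.le hq1 2 3).mul_left
    (E * D * Real.exp (-(Real.pi * b⁻¹)))
  have hge := tsum_ge_head_sub hpair.summable hB.summable (fun m => by
    rw [neg_le]
    refine (neg_le_abs _).trans ?_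
    rw [abs_mul, abs_pow, abs_neg, abs_one, one_pow, one_mul]
    have p1 : 0 ≤ 1 - Real.exp (-((2 * ((m + 1 : ℕ) : ℝ) + 1) * X)) :=
      sub_nonneg.mpr (Real.exp_le_one_iff.mpr (by rw [neg_nonpos]; positivity))
    rw [abs_of_nonneg (mul_nonneg (Real.exp_pos _).le p1)]
    have p2 := one_sub_exp_neg_mul_le (k := 2 * ((m + 1 : ℕ) : ℝ) + 1) (u := X)
      (by linarith [(Nat.cast_nonneg (m + 1) : (0 : ℝ) ≤ ((m + 1 : ℕ) : ℝ))])
    have p3 : Real.exp (-(Real.pi / b * (((m + 1 : ℕ) : ℝ) + x) ^ 2)) ≤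
        E * (Real.exp (-(Real.pi * b⁻¹)) * Real.exp (-(Real.pi * b⁻¹)) ^ m) := by
      rw [← Real.exp_nat_mul, ← Real.exp_add, ← Real.exp_add, Real.exp_le_exp]
      have : x ^ 2 + 1 + m ≤ (((m + 1 : ℕ) : ℝ) + x) ^ 2 := by
        push_cast
        nlinarith [mul_nonneg h0 (Nat.cast_nonneg m : (0 : ℝ) ≤ m), sq_nonneg (m : ℝ),
          (Nat.cast_nonneg m : (0 : ℝ) ≤ m)]
      have h2 := mul_le_mul_of_nonneg_left this (div_pos Real.pi_pos hb0).le
      rw [show Real.pi * b⁻¹ = Real.pi / b from rfl]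
      linarith
    calc _ ≤ (E * (Real.exp (-(Real.pi * b⁻¹)) * Real.exp (-(Real.pi * b⁻¹)) ^ m)) *
          ((2 * ((m + 1 : ℕ) : ℝ) + 1) * D) := by
          gcongr
      _ = _ := by push_cast; ring)
  rw [hpair.tsum_eq, hB.tsum_eq] at hge
  have hz : (-1 : ℝ) ^ 0 * (Real.exp (-(Real.pi / b * (((0 : ℕ) : ℝ) + x) ^ 2)) *
        (1 - Real.exp (-((2 * ((0 : ℕ) : ℝ) + 1) * X)))) = E * D := by
    simp [hEdef, hD]
  rw [hz] at hge
  have hsum := affine_geometric_le (ρ := Real.exp (-(Real.pi * b⁻¹))) (p := 2) (q := 3)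
    (by linarith) (by norm_num) (by norm_num)
  have hED : 0 < E * D := mul_pos hE hD0
  have h1 : 0.9 * (E * D) ≤ 2 * Real.sqrt b * oddRow b x := by
    refine le_trans ?_ hge
    have := mul_le_mul_of_nonneg_left hsum
      (mul_pos hED hq0).le
    have := mul_le_mul_of_nonneg_left hq hED.le
    nlinarith
  have hDs : 0.7 * Real.sin (Real.pi * (1 - 2 * x) / 4) ≤ D := by
    have := mul_sin_quarter_le_one_sub_exp (k := 4 * b⁻¹) (by linarith) h0 hx
    rwa [show 4 * b⁻¹ * (Real.pi * (1 - 2 * x) / 4) = X by rw [hX]; ring] at this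
  have hEe : Real.exp (-Real.pi * (b⁻¹ / 4)) ≤ E := by
    rw [hEdef, Real.exp_le_exp]
    have : x ^ 2 ≤ 1 / 4 := by nlinarith
    have := mul_le_mul_of_nonneg_left this (div_pos Real.pi_pos hb0).le
    rw [show -Real.pi * (b⁻¹ / 4) = -(Real.pi / b * (1 / 4)) by ring]
    linarith
  have hsq : 2 * Real.sqrt b ≤ 1.5 := by
    have : Real.sqrt b ≤ 0.75 := by
      rw [Real.sqrt_le_left (by norm_num)]
      norm_num
      linarith
    linarith
  have hfin : 0.7 * Real.sin (Real.pi * (1 - 2 * x) / 4) * Real.exp (-Real.pi * (b⁻¹ / 4)) ≤ E * D := by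
    rw [mul_comm]
    gcongr
  have hrow : 0 < oddRow b x := by
    have : 0 < 2 * Real.sqrt b * oddRow b x := by nlinarith
    exact (pos_iff_pos_of_mul_pos this).mp (by positivity)
  nlinarith [mul_le_mul_of_nonneg_right hsq hrow.le]

/-- `∑ (-1)^m exp (-π a m²) (cos (π m / 2) - cos (π m x))` over the positive integers `m`. -/
noncomputable def intRow (a x : ℝ) : ℝ :=
  ∑' n : ℕ, (-1 : ℝ) ^ (n + 1) * Real.exp (-Real.pi * a * (n + 1) ^ 2) *
    (Real.cos (Real.pi * (n + 1) * (1 / 2)) - Real.cos (Real.pi * (n + 1) * x))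

theorem abs_intRow_term_le {a x : ℝ} (n : ℕ) : |(-1 : ℝ) ^ (n + 1) *
    Real.exp (-Real.pi * a * (n + 1) ^ 2) *
    (Real.cos (Real.pi * (n + 1) * (1 / 2)) - Real.cos (Real.pi * (n + 1) * x))| ≤
      2 * |Real.sin (Real.pi * (1 - 2 * x) / 4)| * intWeight a n := by
  rw [abs_mul, abs_mul, abs_pow, abs_neg, abs_one, one_pow, one_mul, Real.abs_exp, intWeight]
  have h := abs_cos_natCast_mul_sub_le (n + 1) x
  push_cast at h
  calc _ ≤ Real.exp (-Real.pi * a * (n + 1) ^ 2) *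
        (2 * (n + 1) * |Real.sin (Real.pi * (1 - 2 * x) / 4)|) := by gcongr
    _ = _ := by ring

theorem summable_intRow {a : ℝ} (ha : 0 < a) (x : ℝ) : Summable fun n : ℕ => (-1 : ℝ) ^ (n + 1) *
    Real.exp (-Real.pi * a * (n + 1) ^ 2) *
    (Real.cos (Real.pi * (n + 1) * (1 / 2)) - Real.cos (Real.pi * (n + 1) * x)) :=
  Summable.of_norm_bounded ((summable_intWeight ha).mul_left _) fun n => abs_intRow_term_le n

/-- For `a ≥ 1 / 4` the term of frequency `1` dominates the row. -/
theorem intRow_ge {a x : ℝ} (ha : 1 / 4 ≤ a) (h0 : 0 ≤ x) (hx : x < 1 / 2) :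
    0.8 * Real.sin (Real.pi * (1 - 2 * x) / 4) * Real.exp (-Real.pi * a) ≤ intRow a x := by
  have ha0 : 0 < a := by linarith
  have hs := sin_quarter_pos h0 hx
  have hc := mul_sin_quarter_le_cos h0 hx
  have hE := Real.exp_pos (-Real.pi * a)
  have hq : Real.exp (-(Real.pi * (3 * a))) ≤ 1 / 10 :=
    exp_neg_le_tenth (by nlinarith [Real.pi_gt_d2])
  have h1 := tsum_ge_head_sub (summable_intRow ha0 x)
    (((summable_nat_add_iff 1).mpr (summable_intWeight ha0)).mul_left
      (2 * |Real.sin (Real.pi * (1 - 2 * x) / 4)|)) (fun n => by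
      have := abs_intRow_term_le (a := a) (x := x) (n + 1)
      exact (abs_le.mp this).1)
  rw [tsum_mul_left, abs_of_pos hs, ← intRow] at h1
  have e0 : (-1 : ℝ) ^ (0 + 1) * Real.exp (-Real.pi * a * (((0 : ℕ) : ℝ) + 1) ^ 2) *
      (Real.cos (Real.pi * (((0 : ℕ) : ℝ) + 1) * (1 / 2)) -
        Real.cos (Real.pi * (((0 : ℕ) : ℝ) + 1) * x)) =
      Real.exp (-Real.pi * a) * Real.cos (Real.pi * x) := by
    norm_num
    rw [show Real.pi * (1 / 2) = Real.pi / 2 by ring, Real.cos_pi_div_two]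
    ring
  rw [e0] at h1
  have h2 := tsum_intWeight_succ_le hq ha0
  have e : Real.exp (-Real.pi * (4 * a)) =
      Real.exp (-Real.pi * a) * Real.exp (-(Real.pi * (3 * a))) := by
    rw [← Real.exp_add]; ring_nf
  have h3 : ∑' n, intWeight a (n + 1) ≤ 0.3 * Real.exp (-Real.pi * a) := by
    rw [e] at h2
    nlinarith
  refine le_trans ?_ h1
  nlinarith [mul_le_mul_of_nonneg_left h3 hs.le, mul_le_mul_of_nonneg_left hc hE.le]

/-- For small `a` the row is estimated on the Gaussian side of the Poisson summation formula. -/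
theorem intRow_ge_of_le {a x : ℝ} (ha0 : 0 < a) (ha : a ≤ 1 / 4) (h0 : 0 ≤ x) (hx : x < 1 / 2) :
    0.4 * Real.sin (Real.pi * (1 - 2 * x) / 4) * Real.exp (-Real.pi * (a⁻¹ / 16)) ≤
      intRow a x := by
  have hs := sin_quarter_pos h0 hx
  have hai : 4 ≤ a⁻¹ := by rw [le_inv_comm₀ (by norm_num) ha0]; linarith
  have hcos : ∀ z : ℝ, Summable fun n : ℕ => (-1 : ℝ) ^ (n + 1) *
      Real.exp (-Real.pi * a * (n + 1) ^ 2) * Real.cos (2 * Real.pi * (n + 1) * z) := by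
    intro z
    refine Summable.of_norm_bounded (summable_exp_nat_add_sq ha0 1) fun n => ?_
    rw [norm_mul, norm_mul, norm_pow, norm_neg, norm_one, one_pow, one_mul, Real.norm_eq_abs,
      Real.norm_eq_abs, Real.abs_exp]
    exact mul_le_of_le_one_right (Real.exp_pos _).le (Real.abs_cos_le_one _)
  have hrow : intRow a x = ∑' n : ℕ, (-1 : ℝ) ^ (n + 1) * Real.exp (-Real.pi * a * (n + 1) ^ 2) *
      Real.cos (2 * Real.pi * (n + 1) * (1 / 4)) - ∑' n : ℕ, (-1 : ℝ) ^ (n + 1) *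
      Real.exp (-Real.pi * a * (n + 1) ^ 2) * Real.cos (2 * Real.pi * (n + 1) * (x / 2)) := by
    rw [← (hcos _).tsum_sub (hcos _), intRow]
    congr 1
    ext n
    rw [show Real.pi * (n + 1) * (1 / 2) = 2 * Real.pi * (n + 1) * (1 / 4) by ring,
      show Real.pi * (n + 1) * x = 2 * Real.pi * (n + 1) * (x / 2) by ring]
    ring
  have hpair := ((hasSum_centered_gaussian ha0 (1 / 4)).sub
    (hasSum_centered_gaussian ha0 (x / 2))).nat_add_neg_add_one
  rw [show ∀ S T : ℝ, Real.sqrt a * (1 + 2 * S) - Real.sqrt a * (1 + 2 * T) =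
    2 * Real.sqrt a * (S - T) by intro S T; ring, ← hrow] at hpair
  set Y := Real.pi / a * (1 - 2 * x) / 8 with hY
  have hpa : 0 < Real.pi / a := div_pos Real.pi_pos ha0
  have hY0 : 0 < Y := by
    have := mul_pos hpa (by linarith : 0 < 1 - 2 * x)
    positivity
  set D := 1 - Real.exp (-Y) with hD
  have hD0 : 0 < D := sub_pos.mpr (Real.exp_lt_one_iff.mpr (by linarith))
  set E := Real.exp (-Real.pi * (a⁻¹ / 16)) with hEdef
  have hE : 0 < E := Real.exp_pos _
  set σ := Real.exp (-(Real.pi * (3 / 16 * a⁻¹))) with hσ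
  have hσ0 : 0 < σ := Real.exp_pos _
  have hσ1 : σ ≤ 1 / 10 := exp_neg_le_tenth (by nlinarith [Real.pi_gt_d2])
  have hterm : ∀ m : ℕ, (Real.exp (-Real.pi / a * (((m : ℤ) : ℝ) + 1 / 2 + 1 / 4) ^ 2) -
      Real.exp (-Real.pi / a * (((m : ℤ) : ℝ) + 1 / 2 + x / 2) ^ 2)) +
      (Real.exp (-Real.pi / a * (((-((m : ℤ) + 1) : ℤ) : ℝ) + 1 / 2 + 1 / 4) ^ 2) -
        Real.exp (-Real.pi / a * (((-((m : ℤ) + 1) : ℤ) : ℝ) + 1 / 2 + x / 2) ^ 2)) =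
      (Real.exp (-(Real.pi / a * (m + 1 / 4) ^ 2)) -
        Real.exp (-(Real.pi / a * (m + 1 / 2 - x / 2) ^ 2))) -
      (Real.exp (-(Real.pi / a * (m + 1 / 2 + x / 2) ^ 2)) -
        Real.exp (-(Real.pi / a * (m + 3 / 4) ^ 2))) := by
    intro m
    push_cast
    rw [show -Real.pi / a * ((m : ℝ) + 1 / 2 + 1 / 4) ^ 2 =
        -(Real.pi / a * (m + 3 / 4) ^ 2) by ring,
      show -Real.pi / a * ((m : ℝ) + 1 / 2 + x / 2) ^ 2 =
        -(Real.pi / a * (m + 1 / 2 + x / 2) ^ 2) by ring,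
      show -Real.pi / a * (-((m : ℝ) + 1) + 1 / 2 + 1 / 4) ^ 2 =
        -(Real.pi / a * (m + 1 / 4) ^ 2) by ring,
      show -Real.pi / a * (-((m : ℝ) + 1) + 1 / 2 + x / 2) ^ 2 =
        -(Real.pi / a * (m + 1 / 2 - x / 2) ^ 2) by ring]
    ring
  simp_rw [hterm] at hpair
  -- The first bracket is nonnegative for all `m`, and for `m = 0` it is the main term. The second
  -- one counts with a negative sign, and is bounded by a multiple of `D`, too.
  have hM : ∀ m : ℕ, 0 ≤ Real.exp (-(Real.pi / a * (m + 1 / 4) ^ 2)) -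
      Real.exp (-(Real.pi / a * (m + 1 / 2 - x / 2) ^ 2)) := by
    intro m
    rw [sub_nonneg, Real.exp_le_exp, neg_le_neg_iff]
    gcongr
    linarith
  have hM0 : E * D ≤ Real.exp (-(Real.pi / a * (((0 : ℕ) : ℝ) + 1 / 4) ^ 2)) -
      Real.exp (-(Real.pi / a * (((0 : ℕ) : ℝ) + 1 / 2 - x / 2) ^ 2)) := by
    rw [exp_neg_sub_exp_neg]
    have e : Real.exp (-(Real.pi / a * (((0 : ℕ) : ℝ) + 1 / 4) ^ 2)) = E := by
      rw [hEdef]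
      congr 1
      push_cast
      ring
    rw [e, hD]
    gcongr
    have : (1 - 2 * x) / 8 ≤ (((0 : ℕ) : ℝ) + 1 / 2 - x / 2) ^ 2 - (((0 : ℕ) : ℝ) + 1 / 4) ^ 2 := by
      push_cast
      nlinarith [sq_nonneg (1 / 4 - x / 2)]
    have := mul_le_mul_of_nonneg_left this hpa.le
    linarith
  have hN : ∀ m : ℕ, Real.exp (-(Real.pi / a * (m + 1 / 2 + x / 2) ^ 2)) -
      Real.exp (-(Real.pi / a * (m + 3 / 4) ^ 2)) ≤
      E * D * σ * ((4 * m + 3) * σ ^ m) := by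
    intro m
    have hm : (0 : ℝ) ≤ m := Nat.cast_nonneg m
    rw [exp_neg_sub_exp_neg]
    have p1 : Real.exp (-(Real.pi / a * (m + 1 / 2 + x / 2) ^ 2)) ≤ E * (σ * σ ^ m) := by
      rw [hEdef, hσ, ← Real.exp_nat_mul, ← Real.exp_add, ← Real.exp_add, Real.exp_le_exp]
      have : 1 / 16 + 3 / 16 + m * (3 / 16) ≤ ((m : ℝ) + 1 / 2 + x / 2) ^ 2 := by
        nlinarith [mul_nonneg hm h0]
      have h2 := mul_le_mul_of_nonneg_left this hpa.le
      rw [show a⁻¹ = 1 / a from (one_div a).symm]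
      have e : ∀ c : ℝ, Real.pi * (c * (1 / a)) = Real.pi / a * c := by intro c; ring
      rw [show -Real.pi * (1 / a / 16) = -(Real.pi / a * (1 / 16)) by ring, e]
      linarith
    have p2 : 1 - Real.exp (-(Real.pi / a * (m + 3 / 4) ^ 2 -
        Real.pi / a * (m + 1 / 2 + x / 2) ^ 2)) ≤ (4 * m + 3) * D := by
      refine le_trans ?_ (one_sub_exp_neg_mul_le (by linarith))
      rw [sub_le_sub_iff_left, Real.exp_le_exp, neg_le_neg_iff, hY]
      have : ((m : ℝ) + 3 / 4) ^ 2 - (m + 1 / 2 + x / 2) ^ 2 ≤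
          (4 * m + 3) * ((1 - 2 * x) / 8) := by
        nlinarith [sq_nonneg (1 / 4 - x / 2)]
      have h2 := mul_le_mul_of_nonneg_left this hpa.le
      linarith
    have p3 : 0 ≤ 1 - Real.exp (-(Real.pi / a * ((m : ℝ) + 3 / 4) ^ 2 -
        Real.pi / a * (m + 1 / 2 + x / 2) ^ 2)) := by
      rw [sub_nonneg, Real.exp_le_one_iff, neg_nonpos, sub_nonneg]
      exact mul_le_mul_of_nonneg_left (pow_le_pow_left₀ (by positivity) (by linarith) 2) hpa.le
    calc _ ≤ (E * (σ * σ ^ m)) * ((4 * m + 3) * D) := by gcongr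
      _ = _ := by ring
  have hB := (hasSum_affine_mul_geometric hσ0.le (by linarith) 4 7).mul_left (E * D * σ * σ)
  have hge := tsum_ge_head_sub hpair.summable hB.summable (fun m => by
    have h1 := hM (m + 1)
    have h2 := hN (m + 1)
    have e : E * D * σ * ((4 * ((m + 1 : ℕ) : ℝ) + 3) * σ ^ (m + 1)) =
        E * D * σ * σ * ((4 * m + 7) * σ ^ m) := by
      push_cast
      ring
    rw [e] at h2
    linarith)
  rw [hpair.tsum_eq, hB.tsum_eq] at hge
  have hN0 := hN 0
  have e0 : E * D * σ * ((4 * ((0 : ℕ) : ℝ) + 3) * σ ^ 0) = 3 * (E * D * σ) := by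
    push_cast
    ring
  rw [e0] at hN0
  have hED : 0 < E * D := mul_pos hE hD0
  have hsum := affine_geometric_le (p := 4) (q := 7) hσ1 (by norm_num) (by norm_num)
  have h1 : 0.6 * (E * D) ≤ 2 * Real.sqrt a * intRow a x := by
    have k1 := mul_le_mul_of_nonneg_left hsum (mul_pos (mul_pos hED hσ0) hσ0).le
    have k2 := mul_le_mul_of_nonneg_left hσ1 hED.le
    have k3 := mul_le_mul_of_nonneg_left hσ1 (mul_pos hED hσ0).le
    linarith
  have hDs : 0.7 * Real.sin (Real.pi * (1 - 2 * x) / 4) ≤ D := by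
    have := mul_sin_quarter_le_one_sub_exp (k := a⁻¹ / 2) (by linarith) h0 hx
    rwa [show a⁻¹ / 2 * (Real.pi * (1 - 2 * x) / 4) = Y by rw [hY]; ring] at this
  have hsq : 2 * Real.sqrt a ≤ 1 := by
    have : Real.sqrt a ≤ 1 / 2 := by
      rw [Real.sqrt_le_left (by norm_num)]
      norm_num
      linarith
    linarith
  have hrow0 : 0 < intRow a x := by
    have : 0 < 2 * Real.sqrt a * intRow a x := by linarith
    exact (pos_iff_pos_of_mul_pos this).mp (by positivity)
  nlinarith [mul_le_mul_of_nonneg_right hsq hrow0.le, mul_le_mul_of_nonneg_left hDs hE.le,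
    mul_pos hs hE]

/-! ### Strict monotonicity in the parameter `x` -/

/-- The variation of a term between `x` and `1 / 2` is at most proportional to its frequency. -/
theorem abs_mixedTerm_sub_le (a b x : ℝ) (p : ℕ × ℕ) :
    |mixedTerm a b (1 / 2) p - mixedTerm a b x p| ≤
      2 * |Real.sin (Real.pi * (1 - 2 * x) / 4)| * (intWeight a p.1 * oddWeight b p.2) := by
  have h := abs_cos_natCast_mul_sub_le ((p.1 + 1) * (2 * p.2 + 1)) x
  push_cast at h
  rw [mixedTerm, mixedTerm, ← mul_sub, abs_mul, abs_mul, abs_mul, abs_pow, abs_neg, abs_one,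
    one_pow, one_mul, Real.abs_exp, Real.abs_exp, intWeight, oddWeight]
  simp only [mul_assoc Real.pi] at h ⊢
  simp only [mul_assoc (((p.1 : ℝ) + 1))] at h ⊢
  calc _ ≤ Real.exp (-Real.pi * a * (p.1 + 1) ^ 2) * Real.exp (-Real.pi * b * (p.2 + 1 / 2) ^ 2) *
        (2 * ((p.1 + 1) * (2 * p.2 + 1)) * |Real.sin (Real.pi * ((1 - 2 * x)) / 4)|) := by
        apply mul_le_mul_of_nonneg_left h (by positivity)
    _ = _ := by ring

theorem tsum_mixedTerm_sub_zero_left (a b x : ℝ) :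
    ∑' l, (mixedTerm a b (1 / 2) (0, l) - mixedTerm a b x (0, l)) =
      Real.exp (-Real.pi * a) * oddRow b x := by
  rw [oddRow, ← tsum_mul_left]
  congr 1
  ext l
  have hc : Real.cos (Real.pi * (((0 : ℕ) : ℝ) + 1) * (2 * l + 1) * (1 / 2)) = 0 := by
    rw [Real.cos_eq_zero_iff]
    exact ⟨l, by push_cast; ring⟩
  rw [mixedTerm, mixedTerm, hc]
  norm_num
  ring

theorem tsum_mixedTerm_sub_zero_right (a b x : ℝ) :
    ∑' n, (mixedTerm a b (1 / 2) (n, 0) - mixedTerm a b x (n, 0)) =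
      Real.exp (-Real.pi * (b / 4)) * intRow a x := by
  rw [intRow, ← tsum_mul_left]
  congr 1
  ext n
  rw [mixedTerm, mixedTerm]
  simp only [Nat.cast_zero, mul_zero, zero_add, mul_one]
  rw [show -Real.pi * b * (1 / 2) ^ 2 = -Real.pi * (b / 4) by ring]
  ring

theorem sq_mul_exp_neg_le {u : ℝ} (hu : 0 ≤ u) : u ^ 2 * Real.exp (-u) ≤ 2 := by
  rw [Real.exp_neg, mul_inv_le_iff₀ (Real.exp_pos u)]
  linarith [Real.quadratic_le_exp_of_nonneg hu]

theorem cube_mul_exp_neg_le {u : ℝ} (hu : 0 ≤ u) : u ^ 3 * Real.exp (-u) ≤ 6 := by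
  rw [Real.exp_neg, mul_inv_le_iff₀ (Real.exp_pos u)]
  have := Real.pow_div_factorial_le_exp u hu 3
  rw [show ((Nat.factorial 3 : ℕ) : ℝ) = 6 by norm_num [Nat.factorial]] at this
  linarith

/-- When `b ≤ a`, the terms of lowest integral frequency dominate. -/
theorem mixedTheta_lt_of_le {a b x : ℝ} (hb : 0 < b) (hba : b ≤ a) (hab : 3 / 4 ≤ a * b)
    (h0 : 0 ≤ x) (hx : x < 1 / 2) : mixedTheta a b x < mixedTheta a b (1 / 2) := by
  have ha : 0 < a := hb.trans_le hba
  have ha' : 0.8 ≤ a := by nlinarith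
  have hs := sin_quarter_pos h0 hx
  have hsum := (summable_mixedTerm ha hb (1 / 2)).sub (summable_mixedTerm ha hb x)
  have hcol := tsum_ge_first_column hsum (summable_intWeight ha) (summable_oddWeight hb)
    (abs_mixedTerm_sub_le a b x)
  rw [tsum_mixedTerm_sub_zero_left, (summable_mixedTerm ha hb (1 / 2)).tsum_sub
    (summable_mixedTerm ha hb x), ← mixedTheta, ← mixedTheta, abs_of_pos hs] at hcol
  set s := Real.sin (Real.pi * (1 - 2 * x) / 4)
  have hA := Real.exp_pos (-Real.pi * a)
  have hρ0 := Real.exp_pos (-(Real.pi * (3 * a)))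
  have hρ : Real.exp (-(Real.pi * (3 * a))) ≤ 1 / 100 :=
    exp_neg_le_hundredth (by nlinarith [Real.pi_gt_three])
  have hU := tsum_intWeight_succ_le (by linarith) ha
  have hV0 : 0 ≤ ∑' l, oddWeight b l := tsum_nonneg (oddWeight_nonneg b)
  have e : Real.exp (-Real.pi * (4 * a)) =
      Real.exp (-Real.pi * a) * Real.exp (-(Real.pi * (3 * a))) := by
    rw [← Real.exp_add]; ring_nf
  rw [e] at hU
  suffices h : 2 * s * (3 * Real.exp (-(Real.pi * (3 * a)))) * ∑' l, oddWeight b l < oddRow b x by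
    have h1 := mul_lt_mul_of_pos_left h hA
    have h2 := mul_le_mul_of_nonneg_right (mul_le_mul_of_nonneg_left hU (by positivity : 0 ≤ 2 * s))
      hV0
    linarith
  rcases le_total (1 / 2) b with hb' | hb'
  · have hrow := oddRow_ge hb' h0 hx
    have hB := Real.exp_pos (-Real.pi * (b / 4))
    have hV : ∑' l, oddWeight b l ≤ 1.2 * Real.exp (-Real.pi * (b / 4)) := by
      have hq : Real.exp (-(Real.pi * (2 * b))) ≤ 1 / 20 :=
        exp_neg_le_twentieth (by nlinarith [Real.pi_gt_three])
      rw [(summable_oddWeight hb).tsum_eq_zero_add, oddWeight_zero]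
      have h1 := tsum_oddWeight_succ_le (by linarith) hb
      have e' : Real.exp (-Real.pi * (9 / 4 * b)) =
          Real.exp (-Real.pi * (b / 4)) * Real.exp (-(Real.pi * (2 * b))) := by
        rw [← Real.exp_add]; ring_nf
      rw [e'] at h1
      nlinarith
    have hsB := mul_pos hs hB
    calc _ ≤ 2 * s * (3 * (1 / 100)) * (1.2 * Real.exp (-Real.pi * (b / 4))) := by gcongr
      _ < 1.12 * s * Real.exp (-Real.pi * (b / 4)) := by nlinarith
      _ ≤ _ := hrow
  · have hrow := oddRow_ge_of_le hb hb' h0 hx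
    have hB := Real.exp_pos (-Real.pi * (b⁻¹ / 4))
    have hV := tsum_oddWeight_le_inv_sq hb hb'
    rw [← inv_pow] at hV
    have hab' : 3 / 4 * b⁻¹ ≤ a := by
      rw [mul_inv_le_iff₀ hb]; exact hab
    set t := b⁻¹
    have ht : 0 < t := inv_pos.mpr hb
    -- The main term may be as small as `exp (-π t / 4)`, but `a ≥ 3 t / 4` compensates for it.
    have hρ' : Real.exp (-(Real.pi * (3 * a))) ≤
        Real.exp (-Real.pi * (t / 4)) * Real.exp (-(2 * Real.pi * t)) := by
      rw [← Real.exp_add, Real.exp_le_exp]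
      nlinarith [mul_le_mul_of_nonneg_left hab' Real.pi_pos.le]
    have hdec : t ^ 2 * Real.exp (-(2 * Real.pi * t)) ≤ 1 / 18 := by
      have h1 := sq_mul_exp_neg_le (u := 2 * Real.pi * t) (by positivity)
      have h2 : 36 * t ^ 2 ≤ (2 * Real.pi * t) ^ 2 := by
        nlinarith [Real.pi_gt_three, sq_nonneg t, mul_nonneg (sq_nonneg t)
          (by nlinarith [Real.pi_gt_three] : 0 ≤ Real.pi ^ 2 - 9)]
      have h3 := mul_le_mul_of_nonneg_right h2 (Real.exp_pos (-(2 * Real.pi * t))).le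
      linarith
    have hsB := mul_pos hs hB
    calc _ ≤ 2 * s * (3 * (Real.exp (-Real.pi * (t / 4)) * Real.exp (-(2 * Real.pi * t)))) *
          t ^ 2 := by gcongr
      _ = 6 * (s * Real.exp (-Real.pi * (t / 4))) * (t ^ 2 * Real.exp (-(2 * Real.pi * t))) := by
          ring
      _ ≤ 6 * (s * Real.exp (-Real.pi * (t / 4))) * (1 / 18) := by gcongr
      _ < 0.4 * s * Real.exp (-Real.pi * (t / 4)) := by nlinarith
      _ ≤ _ := hrow

/-- When `a ≤ b`, the terms of lowest half-integral frequency dominate. -/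
theorem mixedTheta_lt_of_ge {a b x : ℝ} (ha : 0 < a) (hba : a ≤ b) (hab : 3 / 4 ≤ a * b)
    (h0 : 0 ≤ x) (hx : x < 1 / 2) : mixedTheta a b x < mixedTheta a b (1 / 2) := by
  have hb : 0 < b := ha.trans_le hba
  have hb' : 0.86 ≤ b := by nlinarith
  have hs := sin_quarter_pos h0 hx
  have hsum := (summable_mixedTerm ha hb (1 / 2)).sub (summable_mixedTerm ha hb x)
  have hcol := tsum_ge_first_column (summable_swap hsum) (summable_oddWeight hb)
    (summable_intWeight ha) (c := 2 * |Real.sin (Real.pi * (1 - 2 * x) / 4)|) (fun p => by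
      rw [mul_comm (oddWeight b p.1)]
      exact abs_mixedTerm_sub_le a b x (p.2, p.1))
  have hswap : ∑' p : ℕ × ℕ, (mixedTerm a b (1 / 2) (p.2, p.1) - mixedTerm a b x (p.2, p.1)) =
      mixedTheta a b (1 / 2) - mixedTheta a b x := by
    rw [Summable.tsum_prod (summable_swap hsum), ← tsum_prod_swap hsum,
      (summable_mixedTerm ha hb (1 / 2)).tsum_sub (summable_mixedTerm ha hb x), mixedTheta,
      mixedTheta]
  rw [tsum_mixedTerm_sub_zero_right, hswap, abs_of_pos hs] at hcol
  set s := Real.sin (Real.pi * (1 - 2 * x) / 4)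
  have hB := Real.exp_pos (-Real.pi * (b / 4))
  have hρ0 := Real.exp_pos (-(Real.pi * (2 * b)))
  have hρ : Real.exp (-(Real.pi * (2 * b))) ≤ 1 / 100 :=
    exp_neg_le_hundredth (by nlinarith [Real.pi_gt_three])
  have hV := tsum_oddWeight_succ_le (by linarith) hb
  have hU0 : 0 ≤ ∑' n, intWeight a n := tsum_nonneg (intWeight_nonneg a)
  have e : Real.exp (-Real.pi * (9 / 4 * b)) =
      Real.exp (-Real.pi * (b / 4)) * Real.exp (-(Real.pi * (2 * b))) := by
    rw [← Real.exp_add]; ring_nf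
  rw [e] at hV
  suffices h : 2 * s * (4 * Real.exp (-(Real.pi * (2 * b)))) * ∑' n, intWeight a n < intRow a x by
    have h1 := mul_lt_mul_of_pos_left h hB
    have h2 := mul_le_mul_of_nonneg_right (mul_le_mul_of_nonneg_left hV (by positivity : 0 ≤ 2 * s))
      hU0
    linarith
  rcases le_total (1 / 4) a with ha' | ha'
  · have hrow := intRow_ge ha' h0 hx
    have hA := Real.exp_pos (-Real.pi * a)
    have hU : ∑' n, intWeight a n ≤ 1.3 * Real.exp (-Real.pi * a) := by
      have hq : Real.exp (-(Real.pi * (3 * a))) ≤ 1 / 10 :=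
        exp_neg_le_tenth (by nlinarith [Real.pi_gt_d2])
      rw [(summable_intWeight ha).tsum_eq_zero_add, intWeight_zero]
      have h1 := tsum_intWeight_succ_le hq ha
      have e' : Real.exp (-Real.pi * (4 * a)) =
          Real.exp (-Real.pi * a) * Real.exp (-(Real.pi * (3 * a))) := by
        rw [← Real.exp_add]; ring_nf
      rw [e'] at h1
      nlinarith
    have hsA := mul_pos hs hA
    calc _ ≤ 2 * s * (4 * (1 / 100)) * (1.3 * Real.exp (-Real.pi * a)) := by gcongr
      _ < 0.8 * s * Real.exp (-Real.pi * a) := by nlinarith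
      _ ≤ _ := hrow
  · have hrow := intRow_ge_of_le ha ha' h0 hx
    have hA := Real.exp_pos (-Real.pi * (a⁻¹ / 16))
    have hU := tsum_intWeight_le_inv_sq ha ha'
    rw [← inv_pow] at hU
    have hab' : 3 / 4 * a⁻¹ ≤ b := by
      rw [mul_inv_le_iff₀ ha, mul_comm]; exact hab
    have ht4 : 4 ≤ a⁻¹ := by rw [le_inv_comm₀ (by norm_num) ha]; linarith
    set t := a⁻¹
    have ht : 0 < t := inv_pos.mpr ha
    -- The main term may be as small as `exp (-π t / 16)`, but `b ≥ 3 t / 4` compensates for it.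
    have hρ' : Real.exp (-(Real.pi * (2 * b))) ≤
        Real.exp (-Real.pi * (t / 16)) * Real.exp (-(23 / 16 * Real.pi * t)) := by
      rw [← Real.exp_add, Real.exp_le_exp]
      nlinarith [mul_le_mul_of_nonneg_left hab' Real.pi_pos.le]
    have hdec : t ^ 2 * Real.exp (-(23 / 16 * Real.pi * t)) ≤ 1 / 40 := by
      have h1 := cube_mul_exp_neg_le (u := 23 / 16 * Real.pi * t) (by positivity)
      have h2 : 240 * t ^ 2 ≤ (23 / 16 * Real.pi * t) ^ 3 := by
        have h3 : 4 * t ≤ 23 / 16 * Real.pi * t := by nlinarith [Real.pi_gt_three]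
        calc 240 * t ^ 2 ≤ (4 * t) ^ 3 := by nlinarith [sq_nonneg t]
          _ ≤ _ := by gcongr
      have h3 := mul_le_mul_of_nonneg_right h2 (Real.exp_pos (-(23 / 16 * Real.pi * t))).le
      linarith
    have hsA := mul_pos hs hA
    calc _ ≤ 2 * s * (4 * (Real.exp (-Real.pi * (t / 16)) *
          Real.exp (-(23 / 16 * Real.pi * t)))) * t ^ 2 := by gcongr
      _ = 8 * (s * Real.exp (-Real.pi * (t / 16))) *
          (t ^ 2 * Real.exp (-(23 / 16 * Real.pi * t))) := by ring
      _ ≤ 8 * (s * Real.exp (-Real.pi * (t / 16))) * (1 / 40) := by gcongr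
      _ < 0.4 * s * Real.exp (-Real.pi * (t / 16)) := by nlinarith
      _ ≤ _ := hrow

/-- The cosine series is strictly larger at `x = 1 / 2` than at any other point of `[0, 1 / 2]`. -/
theorem mixedTheta_lt {a b x : ℝ} (ha : 0 < a) (hb : 0 < b) (hab : 3 / 4 ≤ a * b)
    (h0 : 0 ≤ x) (hx : x < 1 / 2) : mixedTheta a b x < mixedTheta a b (1 / 2) := by
  rcases le_total b a with h | h
  · exact mixedTheta_lt_of_le hb h hab h0 hx
  · exact mixedTheta_lt_of_ge ha h hab h0 hx

/-- The alternating theta function as a function of the parameters `(x, y)`. -/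
noncomputable def alternatingParam (β x y : ℝ) : ℝ :=
  2 * Real.sqrt (y / β) * (halfTheta (y / β) + 2 * mixedTheta (β * y) (y / β) x)

theorem alternatingParam_half {β y : ℝ} (hβ : 0 < β) (hy : 0 < y) :
    alternatingParam β (1 / 2) y = thetaFour (β / y) * thetaFour (4 * β * y) := by
  rw [alternatingParam, halfTheta_add_mixedTheta_half (by positivity) (by positivity),
    ← mul_assoc, two_sqrt_mul_halfTheta (by positivity), one_div_div, mul_assoc]

theorem alternatingParam_abs (β x y : ℝ) : alternatingParam β |x| y = alternatingParam β x y := by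
  rw [alternatingParam, alternatingParam, mixedTheta_abs]

theorem sq_ge_of_reduced {x y : ℝ} (hx : |x| ≤ 1 / 2) (hxy : 1 ≤ x ^ 2 + y ^ 2) :
    3 / 4 ≤ y ^ 2 := by
  have : x ^ 2 ≤ (1 / 2) ^ 2 := sq_le_sq' (by linarith [(abs_le.mp hx).1]) (abs_le.mp hx).2
  linarith

/-- Over the reduced region `|x| ≤ 1 / 2`, `x² + y² ≥ 1` the hexagonal point is the strict maximum
of the alternating theta function, up to the sign of `x`. -/
theorem alternatingParam_lt {β x y : ℝ} (hβ : 0 < β) (hy : 0 < y) (hx : |x| ≤ 1 / 2)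
    (hxy : 1 ≤ x ^ 2 + y ^ 2) (hne : ¬ (|x| = 1 / 2 ∧ y = Real.sqrt 3 / 2)) :
    alternatingParam β x y < alternatingParam β (1 / 2) (Real.sqrt 3 / 2) := by
  have hy2 := sq_ge_of_reduced hx hxy
  have hy1 : Real.sqrt 3 / 2 ≤ y := by
    have : Real.sqrt 3 ≤ 2 * y := Real.sqrt_le_iff.mpr ⟨by positivity, by nlinarith⟩
    linarith
  have h3 : (1 / 2 : ℝ) ≤ Real.sqrt 3 / 2 := by
    have : (1 : ℝ) ≤ Real.sqrt 3 := Real.le_sqrt_of_sq_le (by norm_num)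
    linarith
  have step1 : |x| < 1 / 2 → alternatingParam β x y < alternatingParam β (1 / 2) y := by
    intro h
    rw [← alternatingParam_abs β x, alternatingParam, alternatingParam]
    have hm := mixedTheta_lt (a := β * y) (b := y / β) (by positivity) (by positivity)
      (by rw [show β * y * (y / β) = y ^ 2 by field_simp]; exact hy2) (abs_nonneg x) h
    have : 0 < Real.sqrt (y / β) := Real.sqrt_pos.mpr (by positivity)
    gcongr
  have step2 : Real.sqrt 3 / 2 < y →
      alternatingParam β (1 / 2) y < alternatingParam β (1 / 2) (Real.sqrt 3 / 2) := by
    intro h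
    rw [alternatingParam_half hβ hy, alternatingParam_half hβ (by positivity)]
    exact thetaFour_mul_lt hβ h3 h
  rcases hx.lt_or_eq with h | h
  · rcases hy1.lt_or_eq with h' | h'
    · exact (step1 h).trans (step2 h')
    · rw [h']
      exact step1 h
  · rcases hy1.lt_or_eq with h' | h'
    · rw [← alternatingParam_abs, h]
      exact step2 h'
    · exact absurd ⟨h, h'.symm⟩ hne

/-- The centered sum at `α` is a multiple of the alternating sum at `1 / α`. -/
theorem centered_eq_alternatingParam {α x y : ℝ} (hα : 0 < α) (hy : 0 < y) (hx : |x| ≤ 1 / 2)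
    (hxy : 1 ≤ x ^ 2 + y ^ 2) :
    ∑' p : ℤ × ℤ, Real.exp (-(Real.pi * α / y) *
      (((p.1 : ℝ) + 1 / 2) ^ 2 + 2 * x * ((p.1 : ℝ) + 1 / 2) * ((p.2 : ℝ) + 1 / 2) +
        (x ^ 2 + y ^ 2) * ((p.2 : ℝ) + 1 / 2) ^ 2)) = 1 / α * alternatingParam (1 / α) x y := by
  rw [centered_eq_mixedTheta hα hy hx hxy, alternatingParam,
    show y / (1 / α) = α * y by field_simp, show 1 / α * y = y / α by ring]
  have : Real.sqrt (α * y) = α * Real.sqrt (y / α) := by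
    rw [show α * y = α ^ 2 * (y / α) by field_simp, Real.sqrt_mul (sq_nonneg α),
      Real.sqrt_sq hα.le]
  rw [this]
  field_simp

/-! ### Lattices of volume one and their parameters -/

theorem toEuclideanLin_apply_two (Q : Matrix (Fin 2) (Fin 2) ℝ)
    (v : EuclideanSpace ℝ (Fin 2)) (i : Fin 2) :
    Matrix.toEuclideanLin Q v i = Q i 0 * v 0 + Q i 1 * v 1 := by
  simp [Matrix.toEuclideanLin, Matrix.mulVec, dotProduct, Fin.sum_univ_two]

theorem inner_two (v w : EuclideanSpace ℝ (Fin 2)) : inner ℝ v w = v 0 * w 0 + v 1 * w 1 := by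
  simp [PiLp.inner_apply, Fin.sum_univ_two]
  ring

theorem norm_sq_two (v : EuclideanSpace ℝ (Fin 2)) : ‖v‖ ^ 2 = v 0 ^ 2 + v 1 ^ 2 := by
  rw [← real_inner_self_eq_norm_sq, inner_two]
  ring

/-- The Gram determinant of a basis of a lattice of covolume one. -/
theorem gram_det_eq_one {L : Submodule ℤ (EuclideanSpace ℝ (Fin 2))} [DiscreteTopology L]
    [IsZLattice ℝ L] (hL : ZLattice.covolume L volume = 1) (b : Module.Basis (Fin 2) ℤ L) :
    ‖b 0‖ ^ 2 * ‖b 1‖ ^ 2 - inner ℝ (b 0 : EuclideanSpace ℝ (Fin 2)) (b 1) ^ 2 = 1 := by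
  set e := EuclideanSpace.basisFun (Fin 2) ℝ
  have h := ZLattice.covolume_eq_det_mul_measureReal L volume b e.toBasis
  have hv : (volume : Measure (EuclideanSpace ℝ (Fin 2))).real
      (ZSpan.fundamentalDomain e.toBasis) = 1 := by
    rw [Measure.real, measure_congr (ZSpan.fundamentalDomain_ae_parallelepiped e.toBasis volume)]
    rw [OrthonormalBasis.coe_toBasis, OrthonormalBasis.volume_parallelepiped, ENNReal.toReal_one]
  rw [hv, mul_one, hL] at h
  have hd : e.toBasis.det (Subtype.val ∘ b) = (b 0).1 0 * (b 1).1 1 - (b 0).1 1 * (b 1).1 0 := by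
    rw [Module.Basis.det_apply, Matrix.det_fin_two]
    simp [Module.Basis.toMatrix_apply, e]
    ring
  rw [hd] at h
  have h2 := congrArg (· ^ 2) h
  simp only [sq_abs] at h2
  rw [← Submodule.norm_coe, ← Submodule.norm_coe, norm_sq_two, norm_sq_two, inner_two]
  nlinarith

/-- The columns of the generating matrix of the hexagonal lattice, as a basis over `ℤ`. -/
noncomputable def hexIntBasis : Module.Basis (Fin 2) ℤ hexLattice :=
  Module.Basis.span (linearIndependent_hexVectors.restrict_scalars' ℤ)

theorem hexIntBasis_apply (i : Fin 2) :
    (hexIntBasis i : EuclideanSpace ℝ (Fin 2)) = hexVectors i := by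
  rw [hexIntBasis]
  exact congrArg Subtype.val
    (Module.Basis.span_apply (linearIndependent_hexVectors.restrict_scalars' ℤ) i)

theorem norm_sq_hexVectors_zero : ‖hexVectors 0‖ ^ 2 = 2 / Real.sqrt 3 := by
  rw [norm_sq_two]
  have hc : Real.sqrt (2 / Real.sqrt 3) ^ 2 = 2 / Real.sqrt 3 := Real.sq_sqrt (by positivity)
  simp only [hexVectors, Matrix.cons_val_one, Matrix.cons_val_fin_one, PiLp.smul_apply, smul_eq_mul,
    Matrix.cons_val_zero, mul_pow, hc]
  ring

theorem norm_sq_hexVectors_one : ‖hexVectors 1‖ ^ 2 = 2 / Real.sqrt 3 := by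
  rw [norm_sq_two]
  have h3 : Real.sqrt 3 ^ 2 = 3 := Real.sq_sqrt (by norm_num)
  have hc : Real.sqrt (2 / Real.sqrt 3) ^ 2 = 2 / Real.sqrt 3 := Real.sq_sqrt (by positivity)
  simp only [hexVectors, Matrix.cons_val_one, Matrix.cons_val_fin_one, PiLp.smul_apply, smul_eq_mul,
    Matrix.cons_val_zero, mul_pow, hc, div_pow, h3]
  ring

theorem inner_hexVectors : inner ℝ (hexVectors 0) (hexVectors 1) = 1 / Real.sqrt 3 := by
  rw [inner_two]
  have hc : Real.sqrt (2 / Real.sqrt 3) ^ 2 = 2 / Real.sqrt 3 := Real.sq_sqrt (by positivity)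
  simp only [hexVectors, Matrix.cons_val_one, Matrix.cons_val_fin_one, PiLp.smul_apply, smul_eq_mul,
    Matrix.cons_val_zero, mul_zero, zero_mul, add_zero, mul_one]
  linear_combination (1 / 2 : ℝ) * hc

theorem isMinkowskiBasis_of_hex_gram {L : Submodule ℤ (EuclideanSpace ℝ (Fin 2))}
    {b : Module.Basis (Fin 2) ℤ L} (h0 : ‖b 0‖ ^ 2 = 2 / Real.sqrt 3)
    (h1 : ‖b 1‖ ^ 2 = 2 / Real.sqrt 3)
    (hB : inner ℝ (b 0 : EuclideanSpace ℝ (Fin 2)) (b 1) = 1 / Real.sqrt 3) :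
    IsMinkowskiBasis b := by
  refine ⟨?_, ?_⟩
  · exact (pow_le_pow_iff_left₀ (norm_nonneg _) (norm_nonneg _) two_ne_zero).mp (by rw [h0, h1])
  · rw [hB, h0, abs_of_pos (by positivity)]
    apply le_of_eq
    ring

/-- The two theta functions of a lattice with parameters `(x, y)`. -/
theorem theta_eq_param {L : Submodule ℤ (EuclideanSpace ℝ (Fin 2))} [DiscreteTopology L]
    [IsZLattice ℝ L] {b : Module.Basis (Fin 2) ℤ L} (hb : IsMinkowskiBasis b) {α x y : ℝ}
    (hα : 0 < α) (hy : 0 < y) (hx : |x| ≤ 1 / 2) (hxy : 1 ≤ x ^ 2 + y ^ 2)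
    (h₁ : ‖b 0‖ ^ 2 = 1 / y) (h₂ : inner ℝ (b 0 : EuclideanSpace ℝ (Fin 2)) (b 1) = x / y)
    (h₃ : ‖b 1‖ ^ 2 = (x ^ 2 + y ^ 2) / y) :
    centeredTheta L α = 1 / α * alternatingParam (1 / α) x y ∧
      alternatingTheta L α = alternatingParam α x y := by
  rw [centeredTheta_eq L b hb, alternatingTheta_eq L b hb,
    centeredSum_eq_param _ _ α x y (by rw [Submodule.norm_coe, h₁]) h₂
      (by rw [Submodule.norm_coe, h₃]),
    alternatingSum_eq_param _ _ α x y (by rw [Submodule.norm_coe, h₁]) h₂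
      (by rw [Submodule.norm_coe, h₃]),
    centered_eq_alternatingParam hα hy hx hxy, alternating_eq_mixedTheta hα hy hx hxy]
  exact ⟨rfl, rfl⟩

theorem theta_eq_of_hex_gram {L : Submodule ℤ (EuclideanSpace ℝ (Fin 2))} [DiscreteTopology L]
    [IsZLattice ℝ L] {b : Module.Basis (Fin 2) ℤ L} {α : ℝ} (hα : 0 < α)
    (h0 : ‖b 0‖ ^ 2 = 2 / Real.sqrt 3) (h1 : ‖b 1‖ ^ 2 = 2 / Real.sqrt 3)
    (hB : inner ℝ (b 0 : EuclideanSpace ℝ (Fin 2)) (b 1) = 1 / Real.sqrt 3) :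
    centeredTheta L α = 1 / α * alternatingParam (1 / α) (1 / 2) (Real.sqrt 3 / 2) ∧
      alternatingTheta L α = alternatingParam α (1 / 2) (Real.sqrt 3 / 2) := by
  have h3 : Real.sqrt 3 ^ 2 = 3 := Real.sq_sqrt (by norm_num)
  have hpos : 0 < Real.sqrt 3 := by positivity
  refine theta_eq_param (isMinkowskiBasis_of_hex_gram h0 h1 hB) hα (by positivity)
    (by rw [abs_of_pos (by norm_num)]) (by nlinarith) (by rw [h0, one_div_div]) ?_ ?_
  · rw [hB]
    field_simp
  · rw [h1, show ((1 / 2 : ℝ) ^ 2 + (Real.sqrt 3 / 2) ^ 2) = 1 by nlinarith, one_div_div]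

theorem hexLattice_theta {α : ℝ} (hα : 0 < α) :
    centeredTheta hexLattice α = 1 / α * alternatingParam (1 / α) (1 / 2) (Real.sqrt 3 / 2) ∧
      alternatingTheta hexLattice α = alternatingParam α (1 / 2) (Real.sqrt 3 / 2) := by
  apply theta_eq_of_hex_gram (b := hexIntBasis) hα
  · rw [← Submodule.norm_coe, hexIntBasis_apply, norm_sq_hexVectors_zero]
  · rw [← Submodule.norm_coe, hexIntBasis_apply, norm_sq_hexVectors_one]
  · rw [hexIntBasis_apply, hexIntBasis_apply, inner_hexVectors]

theorem inner_toEuclideanLin {Q : Matrix (Fin 2) (Fin 2) ℝ}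
    (hQ : Q ∈ Matrix.specialOrthogonalGroup (Fin 2) ℝ) (v w : EuclideanSpace ℝ (Fin 2)) :
    inner ℝ (Matrix.toEuclideanLin Q v) (Matrix.toEuclideanLin Q w) = inner ℝ v w := by
  have h := (Matrix.mem_orthogonalGroup_iff' _ _).mp (Matrix.mem_specialOrthogonalGroup_iff.mp hQ).1
  have h00 := congrFun (congrFun h 0) 0
  have h01 := congrFun (congrFun h 0) 1
  have h11 := congrFun (congrFun h 1) 1
  simp [Matrix.mul_apply, Fin.sum_univ_two] at h00 h01 h11
  rw [inner_two, inner_two]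
  simp only [toEuclideanLin_apply_two]
  linear_combination (v 0 * w 0) * h00 + (v 0 * w 1 + v 1 * w 0) * h01 + (v 1 * w 1) * h11

theorem norm_toEuclideanLin {Q : Matrix (Fin 2) (Fin 2) ℝ}
    (hQ : Q ∈ Matrix.specialOrthogonalGroup (Fin 2) ℝ) (v : EuclideanSpace ℝ (Fin 2)) :
    ‖Matrix.toEuclideanLin Q v‖ = ‖v‖ := by
  rw [norm_eq_sqrt_real_inner, inner_toEuclideanLin hQ, ← norm_eq_sqrt_real_inner]

/-- A rotation carries a basis to a basis with the same Gram matrix. -/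
theorem IsRotationOf.exists_basis {L M : Submodule ℤ (EuclideanSpace ℝ (Fin 2))}
    (h : IsRotationOf L M) (e : Module.Basis (Fin 2) ℤ M) :
    ∃ b : Module.Basis (Fin 2) ℤ L, (∀ i, ‖b i‖ = ‖e i‖) ∧
      inner ℝ (b 0 : EuclideanSpace ℝ (Fin 2)) (b 1) =
        inner ℝ (e 0 : EuclideanSpace ℝ (Fin 2)) (e 1) := by
  obtain ⟨Q, hQ, hL⟩ := h
  let f : EuclideanSpace ℝ (Fin 2) →ₗ[ℤ] EuclideanSpace ℝ (Fin 2) :=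
    (Matrix.toEuclideanLin Q).restrictScalars ℤ
  have hf : Function.Injective f := by
    rw [injective_iff_map_eq_zero]
    intro v hv
    have := norm_toEuclideanLin hQ v
    rw [show Matrix.toEuclideanLin Q v = 0 from hv, norm_zero] at this
    exact norm_eq_zero.mp this.symm
  have hLf : M.map f = L := SetLike.coe_injective (by rw [hL]; rfl)
  let g : M ≃ₗ[ℤ] L := (Submodule.equivMapOfInjective f hf M).trans (LinearEquiv.ofEq _ _ hLf)
  have hg : ∀ v, (g v : EuclideanSpace ℝ (Fin 2)) = Matrix.toEuclideanLin Q v := fun v => rfl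
  refine ⟨e.map g, fun i => ?_, ?_⟩
  · rw [Module.Basis.map_apply, ← Submodule.norm_coe, hg, norm_toEuclideanLin hQ,
      Submodule.norm_coe]
  · rw [Module.Basis.map_apply, Module.Basis.map_apply, hg, hg, inner_toEuclideanLin hQ]

theorem theta_eq_of_isRotationOf {L : Submodule ℤ (EuclideanSpace ℝ (Fin 2))} [DiscreteTopology L]
    [IsZLattice ℝ L] {α : ℝ} (hα : 0 < α) (h : IsRotationOf L hexLattice) :
    centeredTheta L α = centeredTheta hexLattice α ∧
      alternatingTheta L α = alternatingTheta hexLattice α := by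
  obtain ⟨b, hn, hi⟩ := h.exists_basis hexIntBasis
  rw [(hexLattice_theta hα).1, (hexLattice_theta hα).2]
  apply theta_eq_of_hex_gram (b := b) hα
  · rw [hn, ← Submodule.norm_coe, hexIntBasis_apply, norm_sq_hexVectors_zero]
  · rw [hn, ← Submodule.norm_coe, hexIntBasis_apply, norm_sq_hexVectors_one]
  · rw [hi, hexIntBasis_apply, hexIntBasis_apply, inner_hexVectors]

theorem mem_iff_exists_comb {L : Submodule ℤ (EuclideanSpace ℝ (Fin 2))}
    (b : Module.Basis (Fin 2) ℤ L) (v : EuclideanSpace ℝ (Fin 2)) :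
    v ∈ L ↔ ∃ m n : ℤ, v = (m : ℝ) • (b 0 : EuclideanSpace ℝ (Fin 2)) +
      (n : ℝ) • (b 1 : EuclideanSpace ℝ (Fin 2)) := by
  constructor
  · intro hv
    have h := congrArg Subtype.val (b.sum_repr ⟨v, hv⟩)
    rw [Fin.sum_univ_two] at h
    refine ⟨b.repr ⟨v, hv⟩ 0, b.repr ⟨v, hv⟩ 1, ?_⟩
    simpa [Int.cast_smul_eq_zsmul] using h.symm
  · rintro ⟨m, n, rfl⟩
    rw [Int.cast_smul_eq_zsmul, Int.cast_smul_eq_zsmul]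
    exact L.add_mem (L.smul_mem m (b 0).2) (L.smul_mem n (b 1).2)

/-- A lattice of volume one with the Gram matrix of the hexagonal lattice, up to the sign of the
off-diagonal entries, is a rotation of it: a rotation that matches the first basis vectors maps
the second vector of the hexagonal basis to one of `± b₁`, `b₀ - b₁`, `b₀ + b₁`. -/
theorem isRotationOf_hexLattice {L : Submodule ℤ (EuclideanSpace ℝ (Fin 2))}
    (b : Module.Basis (Fin 2) ℤ L) (h0 : ‖b 0‖ ^ 2 = 2 / Real.sqrt 3)
    (hB : |inner ℝ (b 0 : EuclideanSpace ℝ (Fin 2)) (b 1)| = 1 / Real.sqrt 3)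
    (hdet : ‖b 0‖ ^ 2 * ‖b 1‖ ^ 2 - inner ℝ (b 0 : EuclideanSpace ℝ (Fin 2)) (b 1) ^ 2 = 1) :
    IsRotationOf L hexLattice := by
  set u : EuclideanSpace ℝ (Fin 2) := (b 0 : EuclideanSpace ℝ (Fin 2)) with hu
  set v : EuclideanSpace ℝ (Fin 2) := (b 1 : EuclideanSpace ℝ (Fin 2)) with hv
  rw [← Submodule.norm_coe, norm_sq_two] at h0
  rw [← Submodule.norm_coe, ← Submodule.norm_coe, norm_sq_two, norm_sq_two] at hdet
  rw [← hu] at h0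
  rw [← hu, ← hv] at hdet
  rw [inner_two] at hB hdet
  have hpos : 0 < Real.sqrt 3 := by positivity
  have h3 : Real.sqrt 3 ^ 2 = 3 := Real.sq_sqrt (by norm_num)
  set c := Real.sqrt (2 / Real.sqrt 3) with hc
  have hc0 : 0 < c := by positivity
  have hc2 : c ^ 2 = 2 / Real.sqrt 3 := Real.sq_sqrt (by positivity)
  have hA : (2 / Real.sqrt 3) * (Real.sqrt 3 / 2) = 1 := by field_simp
  have hv0 : v 0 = Real.sqrt 3 / 2 * ((u 0 * v 0 + u 1 * v 1) * u 0 -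
      (u 0 * v 1 - u 1 * v 0) * u 1) := by
    linear_combination (-(Real.sqrt 3 / 2) * v 0) * h0 - v 0 * hA
  have hv1 : v 1 = Real.sqrt 3 / 2 * ((u 0 * v 0 + u 1 * v 1) * u 1 +
      (u 0 * v 1 - u 1 * v 0) * u 0) := by
    linear_combination (-(Real.sqrt 3 / 2) * v 1) * h0 - v 1 * hA
  have hD : u 0 * v 1 - u 1 * v 0 = 1 ∨ u 0 * v 1 - u 1 * v 0 = -1 := by
    rw [← sq_eq_sq_iff_eq_or_eq_neg]
    linear_combination hdet
  have hB' : Real.sqrt 3 / 2 * (u 0 * v 0 + u 1 * v 1) = 1 / 2 ∨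
      Real.sqrt 3 / 2 * (u 0 * v 0 + u 1 * v 1) = -(1 / 2) := by
    rcases (abs_eq (by positivity)).mp hB with h | h <;> rw [h]
    · left; field_simp
    · right; field_simp
  set Q : Matrix (Fin 2) (Fin 2) ℝ := !![u 0 / c, -(u 1 / c); u 1 / c, u 0 / c] with hQdef
  have hQ : Q ∈ Matrix.specialOrthogonalGroup (Fin 2) ℝ := by
    rw [hQdef, Matrix.of_mem_specialOrthogonalGroup_fin_two_iff]
    refine ⟨rfl, rfl, ?_⟩
    rw [neg_sq, div_pow, div_pow, ← add_div, h0, hc2, div_self (by positivity)]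
  have hw0 : Matrix.toEuclideanLin Q (hexVectors 0) = u := by
    ext i
    rw [toEuclideanLin_apply_two]
    fin_cases i <;> simp [hQdef, hexVectors, ← hc] <;> field_simp
  set w := Matrix.toEuclideanLin Q (hexVectors 1) with hw
  have hw1 : w 0 = 1 / 2 * u 0 - Real.sqrt 3 / 2 * u 1 := by
    rw [hw, toEuclideanLin_apply_two]
    simp only [hQdef, hexVectors, Matrix.cons_val_one, Matrix.cons_val_fin_one, PiLp.smul_apply,
      smul_eq_mul, Matrix.cons_val_zero, ← hc, Matrix.of_apply, Matrix.cons_val', neg_mul]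
    field_simp
    ring
  have hw2 : w 1 = 1 / 2 * u 1 + Real.sqrt 3 / 2 * u 0 := by
    rw [hw, toEuclideanLin_apply_two]
    simp only [hQdef, hexVectors, Matrix.cons_val_one, Matrix.cons_val_fin_one, PiLp.smul_apply,
      smul_eq_mul, Matrix.cons_val_zero, ← hc, Matrix.of_apply, Matrix.cons_val']
    field_simp
  -- The integers `j` and `δ` depend on the signs of the inner product and of the determinant.
  have key : ∃ j δ : ℤ, δ * δ = 1 ∧ v = (δ : ℝ) • w + (j : ℝ) • u := by
    rcases hB' with hB' | hB' <;> rcases hD with hD | hD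
    · refine ⟨0, 1, by norm_num, ?_⟩
      ext i
      fin_cases i <;> simp [hw1, hw2]
      · linear_combination hv0 + u 0 * hB' - Real.sqrt 3 / 2 * u 1 * hD
      · linear_combination hv1 + u 1 * hB' + Real.sqrt 3 / 2 * u 0 * hD
    · refine ⟨1, -1, by norm_num, ?_⟩
      ext i
      fin_cases i <;> simp [hw1, hw2]
      · linear_combination hv0 + u 0 * hB' - Real.sqrt 3 / 2 * u 1 * hD
      · linear_combination hv1 + u 1 * hB' + Real.sqrt 3 / 2 * u 0 * hD
    · refine ⟨-1, 1, by norm_num, ?_⟩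
      ext i
      fin_cases i <;> simp [hw1, hw2]
      · linear_combination hv0 + u 0 * hB' - Real.sqrt 3 / 2 * u 1 * hD
      · linear_combination hv1 + u 1 * hB' + Real.sqrt 3 / 2 * u 0 * hD
    · refine ⟨0, -1, by norm_num, ?_⟩
      ext i
      fin_cases i <;> simp [hw1, hw2]
      · linear_combination hv0 + u 0 * hB' - Real.sqrt 3 / 2 * u 1 * hD
      · linear_combination hv1 + u 1 * hB' + Real.sqrt 3 / 2 * u 0 * hD
  obtain ⟨j, δ, hδ, hvw⟩ := key
  have hδ' : (δ : ℝ) * δ = 1 := by exact_mod_cast hδ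
  have hwv : w = (δ : ℝ) • v + (-((δ : ℝ) * j)) • u := by
    rw [hvw, smul_add, smul_smul, smul_smul, hδ']
    module
  refine ⟨Q, hQ, ?_⟩
  ext z
  constructor
  · intro hz
    obtain ⟨m, n, hmn⟩ := (mem_iff_exists_comb b z).mp hz
    refine ⟨((m + n * j : ℤ) : ℝ) • hexVectors 0 + ((n * δ : ℤ) : ℝ) • hexVectors 1, ?_, ?_⟩
    · rw [SetLike.mem_coe, mem_iff_exists_comb hexIntBasis, hexIntBasis_apply, hexIntBasis_apply]
      exact ⟨_, _, rfl⟩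
    · simp only [map_add, map_smul]
      rw [hw0, ← hw, hmn, ← hu, ← hv, hvw]
      push_cast
      module
  · rintro ⟨z', hz', rfl⟩
    rw [SetLike.mem_coe, mem_iff_exists_comb hexIntBasis, hexIntBasis_apply,
      hexIntBasis_apply] at hz'
    obtain ⟨m, n, rfl⟩ := hz'
    rw [SetLike.mem_coe, mem_iff_exists_comb b]
    refine ⟨m - n * δ * j, n * δ, ?_⟩
    simp only [map_add, map_smul]
    rw [hw0, ← hw, ← hu, ← hv, hwv]
    push_cast
    module

/-- The parameters `y = 1 / |v₁|²` and `x = y ⟨v₁, v₂⟩` of a lattice of volume one. -/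
theorem IsMinkowskiBasis.exists_param {L : Submodule ℤ (EuclideanSpace ℝ (Fin 2))}
    {b : Module.Basis (Fin 2) ℤ L} (hb : IsMinkowskiBasis b)
    (hdet : ‖b 0‖ ^ 2 * ‖b 1‖ ^ 2 - inner ℝ (b 0 : EuclideanSpace ℝ (Fin 2)) (b 1) ^ 2 = 1) :
    ∃ x y : ℝ, 0 < y ∧ |x| ≤ 1 / 2 ∧ 1 ≤ x ^ 2 + y ^ 2 ∧ ‖b 0‖ ^ 2 = 1 / y ∧
      inner ℝ (b 0 : EuclideanSpace ℝ (Fin 2)) (b 1) = x / y ∧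
      ‖b 1‖ ^ 2 = (x ^ 2 + y ^ 2) / y := by
  have hA : 0 < ‖b 0‖ ^ 2 := by
    have h : b 0 ≠ 0 := b.ne_zero 0
    have := norm_pos_iff.mpr h
    positivity
  have hAC : ‖b 0‖ ^ 2 ≤ ‖b 1‖ ^ 2 := pow_le_pow_left₀ (norm_nonneg _) hb.norm_le 2
  have hB := hb.inner_le
  set A := ‖b 0‖ ^ 2
  set C := ‖b 1‖ ^ 2
  set B := inner ℝ (b 0 : EuclideanSpace ℝ (Fin 2)) (b 1)
  refine ⟨B / A, 1 / A, by positivity, ?_, ?_, by rw [one_div_one_div], by field_simp, ?_⟩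
  · rw [abs_div, abs_of_pos hA, div_le_iff₀ hA]
    linarith
  · rw [div_pow, div_pow, ← add_div, le_div_iff₀ (by positivity)]
    nlinarith
  · field_simp
    linarith

theorem theorem1 (α : ℝ) (hα : 0 < α)
    (L : Submodule ℤ (EuclideanSpace ℝ (Fin 2))) [DiscreteTopology L] [IsZLattice ℝ L]
    (hL : ZLattice.covolume L volume = 1) :
    (centeredTheta L α ≤ centeredTheta hexLattice α ∧
      (centeredTheta L α = centeredTheta hexLattice α ↔ IsRotationOf L hexLattice)) ∧
    (alternatingTheta L α ≤ alternatingTheta hexLattice α ∧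
      (alternatingTheta L α = alternatingTheta hexLattice α ↔ IsRotationOf L hexLattice)) := by
  obtain ⟨b, hb⟩ := exists_isMinkowskiBasis L
  have hdet := gram_det_eq_one hL b
  obtain ⟨x, y, hy, hx, hxy, h₁, h₂, h₃⟩ := hb.exists_param hdet
  by_cases hhex : |x| = 1 / 2 ∧ y = Real.sqrt 3 / 2
  · have hrot : IsRotationOf L hexLattice := by
      refine isRotationOf_hexLattice b ?_ ?_ hdet
      · rw [h₁, hhex.2, one_div_div]
      · rw [h₂, abs_div, hhex.1, abs_of_pos hy, hhex.2]
        field_simp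
    obtain ⟨hc, ha⟩ := theta_eq_of_isRotationOf hα hrot
    exact ⟨⟨hc.le, fun _ => hrot, fun _ => hc⟩, ha.le, fun _ => hrot, fun _ => ha⟩
  · have hlt : centeredTheta L α < centeredTheta hexLattice α ∧
        alternatingTheta L α < alternatingTheta hexLattice α := by
      obtain ⟨hc, ha⟩ := theta_eq_param hb hα hy hx hxy h₁ h₂ h₃
      obtain ⟨hc', ha'⟩ := hexLattice_theta hα
      rw [hc, ha, hc', ha']
      exact ⟨mul_lt_mul_of_pos_left (alternatingParam_lt (by positivity) hy hx hxy hhex)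
        (by positivity), alternatingParam_lt hα hy hx hxy hhex⟩
    exact ⟨⟨hlt.1.le, fun h => absurd h hlt.1.ne,
        fun h => (theta_eq_of_isRotationOf hα h).1⟩,
      hlt.2.le, fun h => absurd h hlt.2.ne, fun h => (theta_eq_of_isRotationOf hα h).2⟩
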